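/- Fix an integer $n\ge 2$. **Graphs.** A MOY-type graph is a planar diagram, up to planar isotopy, built by vertical composition $\circ$ and juxtaposition $\otimes$ from the upward strand $\mathrm{id}_1$, the cap $\mathrm{ev}$, the cup $\mathrm{coev}$, the graph $S:\uparrow\uparrow\,\to\,\uparrow\uparrow$ (two strands merging into an edge labelled $2$ and splitting again), an auxiliary graph $T:\uparrow\uparrow\uparrow\,\to\,\uparrow\uparrow\uparrow$, and their duals. Write $\mathrm{id}_2=\mathrm{id}_1\otimes\mathrm{id}_1$. $\Gamma\{m\}$ is $\Gamma$ with a formal shift $m\in\mathbb Z$, $[m]\Gamma=\bigoplus_{t=0}^{m-1}\Gamma\{1-m+2t\}$, and $\emptyset$ is the empty graph. **Morphisms.** Morphisms between formal finite direct sums of shifted graphs (with fixed boundary) are matrices of classes of expressions generated, under $\mathbb Q$-linear combinations, composition, $\circ$, $\otimes$ and shift, by the identities, the canonical isomorphisms between isotopic diagrams (in particular $\Gamma\cong\mathrm{id}\circ\Gamma\cong\Gamma\circ\mathrm{id}$, suppressed from the notation) and the morphisms $$\chi_0:\mathrm{id}_2\to S\{1\},\quad \chi_1:S\{-1\}\to\mathrm{id}_2,\quad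 \epsilon:\mathrm{id}_1\{-1\}\to\mathrm{id}_1\{1\},\quad \alpha,\gamma:S\{-1\}\to S\{1\},$$ the isomorphisms $$\varphi,\psi:S\circ S\to S\{-1\}\oplus S\{1\},\qquad \lambda:\mathrm{ev}\circ\mathrm{coev}\to[n]\emptyset,\qquad \mu:\overline{S}\to[n-1]\,\mathrm{id}_1,$$ $$\nu: S\bowtie S^\vee\to(\mathrm{coev}\circ\mathrm{ev})\oplus[n-2]\,\mathrm{id}_1\otimes\mathrm{id}_1^\vee,\qquad \eta:(S\otimes\mathrm{id}_1)\circ(\mathrm{id}_1\otimes S)\circ(S\otimes\mathrm{id}_1)\to(S\otimes\mathrm{id}_1)\oplus T,$$ and all horizontal and vertical reflections of these. Here $\overline S$ is $S$ with its left strand closed by a cup and a cap, and $S\bowtie S^\vee$ is $S\otimes S^\vee$ with its two middle strands joined at the bottom and at the top. They are taken modulo the axioms of $\mathbb Q$-linear composition, $\circ$ and $\otimes$ (associativity, units, functoriality, exchange, naturality of the canonical isomorphisms), and modulo the following relations and their reflections. Components are listed by increasing shift and matrices act on column vectors. (A) Relations that involve only $\mathrm{id}_2,S,S\circ S$: invertibility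 of $\varphi,\psi$, and $$\chi_1\chi_0=0,\qquad \alpha=(1\circ\chi_1)(\chi_0\circ1),$$ $$\varphi(1\circ\chi_0)=\begin{pmatrix}1\\0\end{pmatrix},\qquad \varphi(\chi_0\circ1)=\begin{pmatrix}1\\\alpha\end{pmatrix},\qquad \psi(\chi_0\circ1)=\begin{pmatrix}1\\\gamma\end{pmatrix},\qquad 1\circ\chi_1=\begin{pmatrix}0&1\end{pmatrix}\varphi,$$ $$\psi(1\circ\alpha)=\begin{pmatrix}0&1\\0&0\end{pmatrix}\varphi,\qquad \varphi(1\circ\gamma)=\begin{pmatrix}0&1\\0&0\end{pmatrix}\psi .$$ (B) The remaining relations: invertibility of $\lambda,\mu,\nu,\eta$, and, with components $\lambda_t,\mu_t$ numbered from $t=0$, and with $\nu_{-}$ the component of $\nu$ in $\mathrm{coev}\circ\mathrm{ev}$ and $\nu_t$ ($0\le t<n-2$) the others: - $\lambda_t\epsilon=\lambda_{t+1}$ for $t<n-1$ and $\lambda_{n-1}\epsilon=0$, on the circle; - $\mu_t(1\otimes\chi_0)=\lambda_{t+1}\otimes1$ for $t<n-1$; - $(\lambda_t\otimes1)(1\otimes\chi_1)=\mu_t$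 for $t<n-1$ and $(\lambda_{n-1}\otimes1)(1\otimes\chi_1)=0$; - $\mu_t(1\otimes\alpha)=0$ and $\mu_t(1\otimes\gamma)=\epsilon\,\mu_t$ for $t<n-1$; - $(1_S\otimes1)\circ(1\otimes\chi_0)=0:(S\otimes\mathrm{id}_1)\circ(\mathrm{id}_1\otimes\mathrm{id}_2)\to(S\otimes\mathrm{id}_1)\circ(\mathrm{id}_1\otimes S)\{1\}$; - $\nu_{-}(\chi_0\otimes1)=0$ and $\nu_t(\chi_0\otimes1)=1\otimes\mu_{t+1}$ for $t<n-2$; - $(\mu_t\otimes1)(1\otimes\chi_1)=\nu_t$ for $t<n-2$ and $(\mu_{n-2}\otimes1)(1\otimes\chi_1)=0$; - $\eta\,(1\circ1\circ(\chi_0\otimes1))=\begin{pmatrix}1\circ(1\otimes\chi_1)\\0\end{pmatrix}$ on $(S\otimes\mathrm{id}_1)\circ(\mathrm{id}_1\otimes S)$. **Complexes.** A formal complex is a bounded cochain complex of formal direct sums of shifted graphs with fixed boundary. Equivalence of formal complexes is the equivalence relation generated by 1. isomorphism of complexes; 2. $\cdots\to M_{i-1}\xrightarrow{\binom{\beta}{A}}N\oplus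 M_i\xrightarrow{\left(\begin{smallmatrix}1&\rho\\0&A\end{smallmatrix}\right)}N\oplus M_{i+1}\xrightarrow{(0\ A)}M_{i+2}\to\cdots$ is equivalent to $(M_\bullet,A)$; 3. $\cdots\to M_{i-1}\xrightarrow{\binom{A}{0}}M_i\oplus N\xrightarrow{\left(\begin{smallmatrix}A&\rho\\0&1\end{smallmatrix}\right)}M_{i+1}\oplus N\xrightarrow{(A\ \beta)}M_{i+2}\to\cdots$ is equivalent to $(M_\bullet,A)$. The morphisms $\vec\imath\to\vec\jmath$ of the category $\mathbf{KR}$ are the equivalence classes of formal complexes with incoming boundary $\vec\imath$ and outgoing boundary $\vec\jmath$, for the relations (A) and (B). **Statement.** For $m\ge0$ let $R_m$ be the complex $$\mathrm{id}_2\xrightarrow{\chi_0}S\{1\}\xrightarrow{\alpha}S\{3\}\xrightarrow{\gamma}S\{5\}\xrightarrow{\alpha}\cdots\to S\{2m-1\}$$ with $m$ terms of the form $S\{\cdot\}$, with $\alpha$ and $\gamma$ alternating, and with $\mathrm{id}_2$ in degree $0$; and let $B_m$ be the bicomplex with two rows $$\begin{array}{ccccccccc}\mathrm{id}_2&\xrightarrow{\chi_0}&S\{1\}&\xrightarrow{\alpha}&S\{3\}&\xrightarrow{\gamma}&\cdots&\to&S\{2m-1\}\\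 \downarrow&&\downarrow&&\downarrow&&&&\downarrow\\ S\{1\}&\xrightarrow{1\circ\chi_0}&S\circ S\{2\}&\xrightarrow{1\circ\alpha}&S\circ S\{4\}&\xrightarrow{1\circ\gamma}&\cdots&\to&S\circ S\{2m\}\end{array}$$ all of whose vertical maps are $\chi_0\circ1$. These are a complex and a bicomplex, and for all $k\ge0$: - the total complex of $B_{2k}$ (top row ending in $\xrightarrow{\alpha}S\{4k-1\}$ if $k\ge 1$) is equivalent to $R_{2k+1}$, that is, to $$\mathrm{id}_2\xrightarrow{\chi_0}S\{1\}\xrightarrow{\alpha}S\{3\}\xrightarrow{\gamma}\cdots\xrightarrow{\alpha}S\{4k-1\}\xrightarrow{\gamma}S\{4k+1\};$$ - the total complex of $B_{2k+1}$ (top row ending in $\xrightarrow{\gamma}S\{4k+1\}$ if $k\ge 1$) is equivalent to $R_{2k+2}$, that is, to $$\mathrm{id}_2\xrightarrow{\chi_0}S\{1\}\xrightarrow{\alpha}S\{3\}\xrightarrow{\gamma}\cdots\xrightarrow{\gamma}S\{4k+1\}\xrightarrow{\alpha}S\{4k+3\}.$$ (For a row with a single term $S\{1\}$ the last map is $\chi_0$.)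 In particular the corresponding morphisms of $\mathbf{KR}$ are equal. Moreover the same two equivalences hold if morphisms are taken modulo the relations (A) only. -/

import Mathlib

open CategoryTheory CategoryTheory.Limits

namespace KR

/-! ### Planar diagrams of MOY type -/

/-- Sequences of `↑` (`true`) and `↓` (`false`). -/
abbrev Word := List Bool

/-- Expressions for planar diagrams built from the elementary pieces by vertical composition
(`comp a b` is `a ∘ b`, with `a` on top of `b`) and juxtaposition. Diagrams are read upwards.
`S true` is the graph `S` on `↑↑` with its edge of label `2`, `T true` is the auxiliary graph `T`
on `↑↑↑`, and `S false`, `T false` are their duals. `ev o` is the cap on the word `[!o, o]` and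
`coev o` the cup with the same boundary word. -/
inductive Diagram : Type
  | idn (w : Word)
  | comp (a b : Diagram)
  | tens (a b : Diagram)
  | ev (o : Bool)
  | coev (o : Bool)
  | S (o : Bool)
  | T (o : Bool)

namespace Diagram

/-- The incoming (bottom) boundary word. -/
def dom : Diagram → Word
  | idn w => w
  | comp _ b => b.dom
  | tens a b => a.dom ++ b.dom
  | ev o => [!o, o]
  | coev _ => []
  | S o => [o, o]
  | T o => [o, o, o]

/-- The outgoing (top) boundary word. -/
def cod : Diagram → Word
  | idn w => w
  | comp a _ => a.cod
  | tens a b => a.cod ++ b.cod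
  | ev _ => []
  | coev o => [!o, o]
  | S o => [o, o]
  | T o => [o, o, o]

/-- All compositions in the expression are compositions of composable diagrams. -/
def WellFormed : Diagram → Prop
  | comp a b => a.WellFormed ∧ b.WellFormed ∧ a.dom = b.cod
  | tens a b => a.WellFormed ∧ b.WellFormed
  | _ => True

/-- Left-right reflection. -/
def hrefl : Diagram → Diagram
  | idn w => idn w.reverse
  | comp a b => comp a.hrefl b.hrefl
  | tens a b => tens b.hrefl a.hrefl
  | ev o => ev (!o)
  | coev o => coev (!o)
  | S o => S o
  | T o => T o

/-- Top-bottom reflection; it reverses all orientations. -/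
def vrefl : Diagram → Diagram
  | idn w => idn (w.map not)
  | comp a b => comp b.vrefl a.vrefl
  | tens a b => tens a.vrefl b.vrefl
  | ev o => coev (!o)
  | coev o => ev (!o)
  | S o => S (!o)
  | T o => T (!o)

/-- The nested caps on `(!o)ᵏ oᵏ`. -/
def evN (o : Bool) : ℕ → Diagram
  | 0 => idn []
  | k + 1 => comp (ev o) (tens (idn [!o]) (tens (evN o k) (idn [o])))

/-- The nested cups on `(!o)ᵏ oᵏ`. -/
def coevN (o : Bool) : ℕ → Diagram
  | 0 => idn []
  | k + 1 => comp (tens (idn [!o]) (tens (coevN o k) (idn [o]))) (coev o)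

/-- The rotation by 180 degrees of a diagram `a : oᵏ → oᵏ`; it goes from `(!o)ᵏ` to `(!o)ᵏ`. -/
def rotate (o : Bool) (k : ℕ) (a : Diagram) : Diagram :=
  comp (tens (evN o k) (idn (List.replicate k !o)))
    (comp (tens (idn (List.replicate k !o)) (tens a (idn (List.replicate k !o))))
      (tens (idn (List.replicate k !o)) (coevN (!o) k)))

end Diagram

open Diagram

/-- Planar isotopy of diagrams (relative to the boundary): the axioms of a strict monoidal category,
the zig-zag moves for cups and caps, and the rotation of `S` and `T` into their duals. -/
inductive Isotopic : Diagram → Diagram → Prop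
  | refl (a) : Isotopic a a
  | symm {a b} : Isotopic a b → Isotopic b a
  | trans {a b c} : Isotopic a b → Isotopic b c → Isotopic a c
  | comp {a a' b b'} : Isotopic a a' → Isotopic b b' → Isotopic (comp a b) (comp a' b')
  | tens {a a' b b'} : Isotopic a a' → Isotopic b b' → Isotopic (tens a b) (tens a' b')
  | assoc (a b c) : Isotopic (comp (comp a b) c) (comp a (comp b c))
  | unit_top (a) : Isotopic a (comp (idn a.cod) a)
  | unit_bot (a) : Isotopic a (comp a (idn a.dom))
  | tens_assoc (a b c) : Isotopic (tens (tens a b) c) (tens a (tens b c))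
  | unit_left (a) : Isotopic a (tens (idn []) a)
  | unit_right (a) : Isotopic a (tens a (idn []))
  | tens_idn (v w) : Isotopic (tens (idn v) (idn w)) (idn (v ++ w))
  | exchange (a b c d) : a.dom = b.cod → c.dom = d.cod →
      Isotopic (tens (comp a b) (comp c d)) (comp (tens a c) (tens b d))
  | zigzag (o) :
      Isotopic (comp (tens (ev !o) (idn [o])) (tens (idn [o]) (coev o))) (idn [o])
  | rotate_S (o) : Isotopic (rotate o 2 (S o)) (S !o)
  | rotate_T (o) : Isotopic (rotate o 3 (T o)) (T !o)
  | hrefl {a b} : Isotopic a b → Isotopic a.hrefl b.hrefl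
  | vrefl {a b} : Isotopic a b → Isotopic a.vrefl b.vrefl

/-! ### The graphs that occur in the elementary morphisms -/

/-- `id₁`, one upward strand. -/
abbrev id1 : Diagram := idn [true]
/-- One downward strand. -/
abbrev id1' : Diagram := idn [false]
/-- `id₂`, two upward strands. -/
abbrev id2 : Diagram := idn [true, true]
/-- The graph `S` on `↑↑`. -/
abbrev gS : Diagram := S true
/-- `S ∘ S`. -/
abbrev gSS : Diagram := comp gS gS
/-- The circle `ev ∘ coev`. -/
abbrev circle : Diagram := comp (ev true) (coev true)
/-- `(ev ⊗ id₁) ∘ (id₁^∨ ⊗ a) ∘ (coev ⊗ id₁)`: the left closure of `a : ↑↑ → ↑↑`. -/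
abbrev closeL (a : Diagram) : Diagram :=
  comp (tens (ev true) id1) (comp (tens id1' a) (tens (coev true) id1))
/-- `(id₁ ⊗ ev ⊗ id₁^∨) ∘ (a ⊗ b) ∘ (id₁ ⊗ coev ⊗ id₁^∨)` for `a` on `↑↑` and `b` on `↓↓`. -/
abbrev joinMid (a b : Diagram) : Diagram :=
  comp (tens id1 (tens (ev false) id1'))
    (comp (tens a b) (tens id1 (tens (coev false) id1')))

/-! ### Elementary morphisms

The morphism `f : Γ{m} → Γ'{m'}` and all its shifts `f{l}` are denoted by the same symbol, so a
morphism symbol has a source `Γ`, a target `Γ'` and a degree `d = m' - m`. A morphism from a graph to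
a direct sum is given by its components. -/

/-- The distinguished invertible elementary morphisms. -/
inductive IsoGen : Type
  | lam | mu | phi | psi | nu | eta

namespace IsoGen

/-- The source graph. -/
def src : IsoGen → Diagram
  | lam => circle
  | mu => closeL gS
  | phi => gSS
  | psi => gSS
  | nu => joinMid gS (S false)
  | eta => comp (comp (tens gS id1) (tens id1 gS)) (tens gS id1)

/-- The number of summands of the target. -/
def len (n : ℕ) : IsoGen → ℕ
  | lam => n
  | mu => n - 1
  | phi => 2
  | psi => 2
  | nu => n - 2 + 1
  | eta => 2

/-- The `t`-th summand of the target, without its shift. -/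
def tgt : IsoGen → ℕ → Diagram
  | lam, _ => idn []
  | mu, _ => id1
  | phi, _ => gS
  | psi, _ => gS
  | nu, 0 => comp (coev false) (ev false)
  | nu, _ + 1 => tens id1 id1'
  | eta, 0 => tens gS id1
  | eta, _ + 1 => T true

/-- The shift of the `t`-th summand of the target; the summands of `[m] Γ` are the `Γ{1 - m + 2t}`
for `t < m`. -/
def deg (n : ℕ) : IsoGen → ℕ → ℤ
  | lam, t => 1 - n + 2 * t
  | mu, t => 1 - (n - 1) + 2 * t
  | phi, t => -1 + 2 * t
  | psi, t => -1 + 2 * t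
  | nu, 0 => 0
  | nu, t + 1 => 1 - (n - 2) + 2 * t
  | eta, _ => 0

end IsoGen

/-- The elementary morphisms, with source, target and degree: `χ₀ : id₂ → S{1}`,
`χ₁ : S{-1} → id₂`, `ε : id₁{-1} → id₁{1}`, `α, γ : S{-1} → S{1}`, and the components of the
distinguished invertible morphisms and of their inverses. -/
inductive Gen (n : ℕ) : Diagram → Diagram → ℤ → Type
  | chi0 : Gen n id2 gS 1
  | chi1 : Gen n gS id2 1
  | eps : Gen n id1 id1 2
  | alpha : Gen n gS gS 2
  | gamma : Gen n gS gS 2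
  | fwd (g : IsoGen) (t : Fin (g.len n)) : Gen n g.src (g.tgt t) (g.deg n t)
  | bwd (g : IsoGen) (t : Fin (g.len n)) : Gen n (g.tgt t) g.src (-g.deg n t)

/-- `(x, y)` is obtained from `(a, b)` by horizontal and vertical reflections. -/
inductive Reflects (a b : Diagram) : Diagram → Diagram → Prop
  | base : Reflects a b a b
  | hrefl {x y} : Reflects a b x y → Reflects a b x.hrefl y.hrefl
  | vrefl {x y} : Reflects a b x y → Reflects a b x.vrefl y.vrefl

/-- Expressions for morphisms of degree `d` from `a` to `b`. They are built from the elementary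
morphisms and their reflections, and from the arrows `iso` that identify isotopic diagrams (among
these are `iᵘ : Γ → id ∘ Γ` and `i_d : Γ → Γ ∘ id`), by `ℚ`-linear combinations, composition
(`seq f g` is `f` followed by `g`), and the operations `∘` and `⊗` of the diagrams. -/
inductive Term (n : ℕ) : Diagram → Diagram → ℤ → Type
  | zero (a b : Diagram) (d : ℤ) : Term n a b d
  | add {a b d} (f g : Term n a b d) : Term n a b d
  | smul {a b d} (c : ℚ) (f : Term n a b d) : Term n a b d
  | id (a : Diagram) {d : ℤ} (hd : d = 0) : Term n a a d
  | seq {a b c d e k} (f : Term n a b d) (g : Term n b c e) (hk : k = d + e) : Term n a c k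
  | hcomp {a a' b b' d e k} (f : Term n a a' d) (g : Term n b b' e) (hk : k = d + e) :
      Term n (a.comp b) (a'.comp b') k
  | tens {a a' b b' d e k} (f : Term n a a' d) (g : Term n b b' e) (hk : k = d + e) :
      Term n (a.tens b) (a'.tens b') k
  | iso {a b d} (h : Isotopic a b) (hd : d = 0) : Term n a b d
  | gen {a b x y d e} (g : Gen n a b e) (h : Reflects a b x y) (hd : d = e) : Term n x y d

namespace Term

variable {n : ℕ}

/-- Left-right reflection of a morphism. -/
def hrefl : ∀ {a b d}, Term n a b d → Term n a.hrefl b.hrefl d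
  | _, _, _, zero a b d => zero a.hrefl b.hrefl d
  | _, _, _, add f g => add f.hrefl g.hrefl
  | _, _, _, smul c f => smul c f.hrefl
  | _, _, _, id a hd => id a.hrefl hd
  | _, _, _, seq f g hk => seq f.hrefl g.hrefl hk
  | _, _, _, hcomp f g hk => hcomp f.hrefl g.hrefl hk
  | _, _, _, tens f g hk => tens g.hrefl f.hrefl (hk.trans (add_comm _ _))
  | _, _, _, iso h hd => iso h.hrefl hd
  | _, _, _, gen g h hd => gen g h.hrefl hd

/-- Top-bottom reflection of a morphism. -/
def vrefl : ∀ {a b d}, Term n a b d → Term n a.vrefl b.vrefl d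
  | _, _, _, zero a b d => zero a.vrefl b.vrefl d
  | _, _, _, add f g => add f.vrefl g.vrefl
  | _, _, _, smul c f => smul c f.vrefl
  | _, _, _, id a hd => id a.vrefl hd
  | _, _, _, seq f g hk => seq f.vrefl g.vrefl hk
  | _, _, _, hcomp f g hk => hcomp g.vrefl f.vrefl (hk.trans (add_comm _ _))
  | _, _, _, tens f g hk => tens f.vrefl g.vrefl hk
  | _, _, _, iso h hd => iso h.vrefl hd
  | _, _, _, gen g h hd => gen g h.vrefl hd

/-- The sum of a list of morphisms. -/
def sum {a b d} (l : List (Term n a b d)) : Term n a b d := l.foldr add (zero a b d)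

/-- An elementary morphism, not reflected. -/
abbrev el {a b e} (g : Gen n a b e) : Term n a b e := gen g .base rfl

/-- The identity, in degree `0`. -/
abbrev one (a : Diagram) : Term n a a 0 := id a rfl

/-- An isotopy, in degree `0`. -/
abbrev isot {a b} (h : Isotopic a b) : Term n a b 0 := iso h rfl

end Term

open Term

/-- A family of relations between morphisms. -/
abbrev Relations (n : ℕ) := ∀ ⦃a b : Diagram⦄ ⦃d : ℤ⦄, Term n a b d → Term n a b d → Prop

/-- The congruence generated by the family `E` of relations (and by their reflections) together with
the structural relations: `ℚ`-linearity, associativity, identities and compatibility of the three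
products, and naturality of the identification of isotopic diagrams. -/
inductive Cong {n : ℕ} (E : Relations n) :
    ∀ {a b : Diagram} {d : ℤ}, Term n a b d → Term n a b d → Prop
  | of {a b d} {f g : Term n a b d} : E f g → Cong E f g
  | refl {a b d} (f : Term n a b d) : Cong E f f
  | symm {a b d} {f g : Term n a b d} : Cong E f g → Cong E g f
  | trans {a b d} {f g h : Term n a b d} : Cong E f g → Cong E g h → Cong E f h
  | hrefl {a b d} {f g : Term n a b d} : Cong E f g → Cong E f.hrefl g.hrefl
  | vrefl {a b d} {f g : Term n a b d} : Cong E f g → Cong E f.vrefl g.vrefl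
  -- compatibility with the operations
  | add_congr {a b d} {f f' g g' : Term n a b d} :
      Cong E f f' → Cong E g g' → Cong E (add f g) (add f' g')
  | smul_congr {a b d} (c : ℚ) {f f' : Term n a b d} : Cong E f f' → Cong E (smul c f) (smul c f')
  | seq_congr {a b c d e k} {f f' : Term n a b d} {g g' : Term n b c e} (hk : k = d + e) :
      Cong E f f' → Cong E g g' → Cong E (seq f g hk) (seq f' g' hk)
  | hcomp_congr {a a' b b' d e k} {f f' : Term n a a' d} {g g' : Term n b b' e} (hk : k = d + e) :
      Cong E f f' → Cong E g g' → Cong E (hcomp f g hk) (hcomp f' g' hk)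
  | tens_congr {a a' b b' d e k} {f f' : Term n a a' d} {g g' : Term n b b' e} (hk : k = d + e) :
      Cong E f f' → Cong E g g' → Cong E (tens f g hk) (tens f' g' hk)
  -- vector space axioms
  | add_assoc {a b d} (f g h : Term n a b d) : Cong E (add (add f g) h) (add f (add g h))
  | add_comm {a b d} (f g : Term n a b d) : Cong E (add f g) (add g f)
  | add_zero {a b d} (f : Term n a b d) : Cong E (add f (zero a b d)) f
  | add_neg {a b d} (f : Term n a b d) : Cong E (add f (smul (-1) f)) (zero a b d)
  | smul_add {a b d} (c : ℚ) (f g : Term n a b d) :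
      Cong E (smul c (add f g)) (add (smul c f) (smul c g))
  | add_smul {a b d} (c c' : ℚ) (f : Term n a b d) :
      Cong E (smul (c + c') f) (add (smul c f) (smul c' f))
  | mul_smul {a b d} (c c' : ℚ) (f : Term n a b d) : Cong E (smul (c * c') f) (smul c (smul c' f))
  | one_smul {a b d} (f : Term n a b d) : Cong E (smul 1 f) f
  -- bilinearity of the three products
  | add_seq {a b c d e k} (f f' : Term n a b d) (g : Term n b c e) (hk : k = d + e) :
      Cong E (seq (add f f') g hk) (add (seq f g hk) (seq f' g hk))
  | seq_add {a b c d e k} (f : Term n a b d) (g g' : Term n b c e) (hk : k = d + e) :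
      Cong E (seq f (add g g') hk) (add (seq f g hk) (seq f g' hk))
  | smul_seq {a b c d e k} (r : ℚ) (f : Term n a b d) (g : Term n b c e) (hk : k = d + e) :
      Cong E (seq (smul r f) g hk) (smul r (seq f g hk))
  | seq_smul {a b c d e k} (r : ℚ) (f : Term n a b d) (g : Term n b c e) (hk : k = d + e) :
      Cong E (seq f (smul r g) hk) (smul r (seq f g hk))
  | add_hcomp {a a' b b' d e k} (f f' : Term n a a' d) (g : Term n b b' e) (hk : k = d + e) :
      Cong E (hcomp (add f f') g hk) (add (hcomp f g hk) (hcomp f' g hk))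
  | hcomp_add {a a' b b' d e k} (f : Term n a a' d) (g g' : Term n b b' e) (hk : k = d + e) :
      Cong E (hcomp f (add g g') hk) (add (hcomp f g hk) (hcomp f g' hk))
  | smul_hcomp {a a' b b' d e k} (r : ℚ) (f : Term n a a' d) (g : Term n b b' e) (hk : k = d + e) :
      Cong E (hcomp (smul r f) g hk) (smul r (hcomp f g hk))
  | hcomp_smul {a a' b b' d e k} (r : ℚ) (f : Term n a a' d) (g : Term n b b' e) (hk : k = d + e) :
      Cong E (hcomp f (smul r g) hk) (smul r (hcomp f g hk))
  | add_tens {a a' b b' d e k} (f f' : Term n a a' d) (g : Term n b b' e) (hk : k = d + e) :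
      Cong E (tens (add f f') g hk) (add (tens f g hk) (tens f' g hk))
  | tens_add {a a' b b' d e k} (f : Term n a a' d) (g g' : Term n b b' e) (hk : k = d + e) :
      Cong E (tens f (add g g') hk) (add (tens f g hk) (tens f g' hk))
  | smul_tens {a a' b b' d e k} (r : ℚ) (f : Term n a a' d) (g : Term n b b' e) (hk : k = d + e) :
      Cong E (tens (smul r f) g hk) (smul r (tens f g hk))
  | tens_smul {a a' b b' d e k} (r : ℚ) (f : Term n a a' d) (g : Term n b b' e) (hk : k = d + e) :
      Cong E (tens f (smul r g) hk) (smul r (tens f g hk))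
  -- category axioms
  | seq_assoc {a b c a' d e l k₁ k₂ k} (f : Term n a b d) (g : Term n b c e) (h : Term n c a' l)
      (h₁ : k₁ = d + e) (h₂ : k = k₁ + l) (h₃ : k₂ = e + l) (h₄ : k = d + k₂) :
      Cong E (seq (seq f g h₁) h h₂) (seq f (seq g h h₃) h₄)
  | id_seq {a b d z} (f : Term n a b d) (hz : z = 0) (hk : d = z + d) :
      Cong E (seq (id a hz) f hk) f
  | seq_id {a b d z} (f : Term n a b d) (hz : z = 0) (hk : d = d + z) :
      Cong E (seq f (id b hz) hk) f
  -- functoriality of `∘` and `⊗`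
  | hcomp_id (a b) {d e k} (hd : d = 0) (he : e = 0) (hk : k = d + e) (hz : k = 0) :
      Cong E (hcomp (id a hd) (id b he) hk) (id (a.comp b) hz)
  | hcomp_seq {a a' a'' b b' b'' d d' e e' k₁ k₂ l₁ l₂ k}
      (f : Term n a a' d) (f' : Term n a' a'' d') (g : Term n b b' e) (g' : Term n b' b'' e')
      (h₁ : k₁ = d + e) (h₂ : k₂ = d' + e') (h₃ : k = k₁ + k₂)
      (h₄ : l₁ = d + d') (h₅ : l₂ = e + e') (h₆ : k = l₁ + l₂) :
      Cong E (seq (hcomp f g h₁) (hcomp f' g' h₂) h₃) (hcomp (seq f f' h₄) (seq g g' h₅) h₆)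
  | tens_id (a b) {d e k} (hd : d = 0) (he : e = 0) (hk : k = d + e) (hz : k = 0) :
      Cong E (tens (id a hd) (id b he) hk) (id (a.tens b) hz)
  | tens_seq {a a' a'' b b' b'' d d' e e' k₁ k₂ l₁ l₂ k}
      (f : Term n a a' d) (f' : Term n a' a'' d') (g : Term n b b' e) (g' : Term n b' b'' e')
      (h₁ : k₁ = d + e) (h₂ : k₂ = d' + e') (h₃ : k = k₁ + k₂)
      (h₄ : l₁ = d + d') (h₅ : l₂ = e + e') (h₆ : k = l₁ + l₂) :
      Cong E (seq (tens f g h₁) (tens f' g' h₂) h₃) (tens (seq f f' h₄) (seq g g' h₅) h₆)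
  -- isotopic diagrams are identified in one way only
  | iso_self {a d} (h : Isotopic a a) (hd : d = 0) : Cong E (iso h hd) (id a hd)
  | iso_seq {a b c d e k} (h : Isotopic a b) (h' : Isotopic b c) (h'' : Isotopic a c)
      (hd : d = 0) (he : e = 0) (hk : k = d + e) (hz : k = 0) :
      Cong E (seq (iso h hd) (iso h' he) hk) (iso h'' hz)
  | iso_hcomp {a a' b b' d e k} (h : Isotopic a a') (h' : Isotopic b b')
      (h'' : Isotopic (a.comp b) (a'.comp b'))
      (hd : d = 0) (he : e = 0) (hk : k = d + e) (hz : k = 0) :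
      Cong E (hcomp (iso h hd) (iso h' he) hk) (iso h'' hz)
  | iso_tens {a a' b b' d e k} (h : Isotopic a a') (h' : Isotopic b b')
      (h'' : Isotopic (a.tens b) (a'.tens b'))
      (hd : d = 0) (he : e = 0) (hk : k = d + e) (hz : k = 0) :
      Cong E (tens (iso h hd) (iso h' he) hk) (iso h'' hz)
  -- associativity and identity axioms for `∘` and `⊗`, and their exchange
  | hcomp_assoc {a a' b b' c c' d e l k₁ k₂ k z}
      (f : Term n a a' d) (g : Term n b b' e) (h : Term n c c' l)
      (h₁ : k₁ = d + e) (h₂ : k = k₁ + l) (h₃ : k₂ = e + l) (h₄ : k = d + k₂)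
      (hz : z = 0) (h₅ : k = k + z) (h₆ : k = z + k) :
      Cong E (seq (hcomp (hcomp f g h₁) h h₂) (iso (.assoc a' b' c') hz) h₅)
        (seq (iso (.assoc a b c) hz) (hcomp f (hcomp g h h₃) h₄) h₆)
  | unit_top {a b d z w} (f : Term n a b d) (ha : Isotopic a (comp (idn w) a))
      (hb : Isotopic b (comp (idn w) b)) (hz : z = 0) (h₁ : d = d + z) (h₂ : d = z + d) :
      Cong E (seq f (iso hb hz) h₁) (seq (iso ha hz) (hcomp (id (idn w) hz) f h₂) h₂)
  | unit_bot {a b d z w} (f : Term n a b d) (ha : Isotopic a (comp a (idn w)))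
      (hb : Isotopic b (comp b (idn w))) (hz : z = 0) (h₁ : d = d + z) (h₂ : d = z + d) :
      Cong E (seq f (iso hb hz) h₁) (seq (iso ha hz) (hcomp f (id (idn w) hz) h₁) h₂)
  | tens_assoc {a a' b b' c c' d e l k₁ k₂ k z}
      (f : Term n a a' d) (g : Term n b b' e) (h : Term n c c' l)
      (h₁ : k₁ = d + e) (h₂ : k = k₁ + l) (h₃ : k₂ = e + l) (h₄ : k = d + k₂)
      (hz : z = 0) (h₅ : k = k + z) (h₆ : k = z + k) :
      Cong E (seq (tens (tens f g h₁) h h₂) (iso (.tens_assoc a' b' c') hz) h₅)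
        (seq (iso (.tens_assoc a b c) hz) (tens f (tens g h h₃) h₄) h₆)
  | unit_left {a b d z} (f : Term n a b d) (hz : z = 0) (h₁ : d = d + z) (h₂ : d = z + d) :
      Cong E (seq f (iso (.unit_left b) hz) h₁)
        (seq (iso (.unit_left a) hz) (tens (id (idn []) hz) f h₂) h₂)
  | unit_right {a b d z} (f : Term n a b d) (hz : z = 0) (h₁ : d = d + z) (h₂ : d = z + d) :
      Cong E (seq f (iso (.unit_right b) hz) h₁)
        (seq (iso (.unit_right a) hz) (tens f (id (idn []) hz) h₁) h₂)
  | exchange {a a' b b' c c' x x' d e l m k₁ k₂ l₁ l₂ k z}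
      (f : Term n a a' d) (g : Term n b b' e) (p : Term n c c' l) (q : Term n x x' m)
      (hs : Isotopic (.tens (.comp a b) (.comp c x)) (.comp (.tens a c) (.tens b x)))
      (ht : Isotopic (.tens (.comp a' b') (.comp c' x')) (.comp (.tens a' c') (.tens b' x')))
      (h₁ : k₁ = d + e) (h₂ : k₂ = l + m) (h₃ : k = k₁ + k₂)
      (h₄ : l₁ = d + l) (h₅ : l₂ = e + m) (h₆ : k = l₁ + l₂)
      (hz : z = 0) (h₇ : k = k + z) (h₈ : k = z + k) :
      Cong E (seq (tens (hcomp f g h₁) (hcomp p q h₂) h₃) (iso ht hz) h₇)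
        (seq (iso hs hz) (hcomp (tens f p h₄) (tens g q h₅) h₆) h₈)

/-! ### The defining relations -/

section relations

variable {n : ℕ}

/-- The components `φ₀ : S ∘ S → S{-1}` and `φ₁ : S ∘ S → S{1}` of `φ`. -/
abbrev phi0 : Term n gSS gS (-1) := gen (.fwd .phi (0 : Fin 2)) .base (by simp [IsoGen.deg])
/-- See `phi0`. -/
abbrev phi1 : Term n gSS gS 1 := gen (.fwd .phi (1 : Fin 2)) .base (by simp [IsoGen.deg])
/-- The components `ψ₀ : S ∘ S → S{-1}` and `ψ₁ : S ∘ S → S{1}` of `ψ`. -/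
abbrev psi0 : Term n gSS gS (-1) := gen (.fwd .psi (0 : Fin 2)) .base (by simp [IsoGen.deg])
/-- See `psi0`. -/
abbrev psi1 : Term n gSS gS 1 := gen (.fwd .psi (1 : Fin 2)) .base (by simp [IsoGen.deg])

/-- `χ₀ ∘ 1 : S → id₂ ∘ S → S ∘ S{1}`. -/
abbrev chi0Top : Term n gS gSS 1 :=
  seq (isot (.unit_top gS)) (hcomp (el .chi0) (one gS) rfl) rfl
/-- `1 ∘ χ₀ : S → S ∘ id₂ → S ∘ S{1}`. -/
abbrev chi0Bot : Term n gS gSS 1 :=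
  seq (isot (.unit_bot gS)) (hcomp (one gS) (el .chi0) rfl) rfl
/-- `1 ∘ χ₁ : S ∘ S → S ∘ id₂{1} → S{1}`. -/
abbrev chi1Bot : Term n gSS gS 1 :=
  seq (hcomp (one gS) (el .chi1) rfl) (isot (.symm (.unit_bot gS))) rfl

/-- The relations that say that the components of `g` and of its inverse are inverse to each
other. -/
inductive InvRel (g : IsoGen) : Relations n
  | bwd_fwd (t) : InvRel g (seq (el (.bwd g t)) (el (.fwd g t)) (neg_add_cancel _).symm)
      (one (g.tgt t))
  | bwd_fwd_ne (s t) (h : s ≠ t) : InvRel g (seq (el (.bwd g s)) (el (.fwd g t)) rfl) (zero _ _ _)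
  | fwd_bwd : InvRel g
      (sum (List.ofFn fun t => seq (el (.fwd g t)) (el (.bwd g t)) (add_neg_cancel _).symm))
      (one g.src)

/-- The defining relations that involve only the graphs `id₂`, `S`, `S ∘ S`. -/
inductive TwoStrandRel (n : ℕ) : Relations n
  | inv_phi {a b d} {f g : Term n a b d} : InvRel .phi f g → TwoStrandRel n f g
  | inv_psi {a b d} {f g : Term n a b d} : InvRel .psi f g → TwoStrandRel n f g
  | chi1_chi0 : TwoStrandRel n (seq (el .chi0) (el .chi1) rfl) (zero id2 id2 (1 + 1))
  | alpha_eq : TwoStrandRel n (el .alpha) (seq chi0Top chi1Bot rfl)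
  | moy2a_0 : TwoStrandRel n (seq chi0Bot phi0 rfl) (one gS)
  | moy2a_1 : TwoStrandRel n (seq chi0Bot phi1 rfl) (zero gS gS (1 + 1))
  | moy2b_0 : TwoStrandRel n (seq chi0Top phi0 rfl) (one gS)
  | moy2b_1 : TwoStrandRel n (seq chi0Top phi1 rfl) (el .alpha)
  | moy2c_0 : TwoStrandRel n (seq chi0Top psi0 rfl) (one gS)
  | moy2c_1 : TwoStrandRel n (seq chi0Top psi1 rfl) (el .gamma)
  | moy2d : TwoStrandRel n chi1Bot phi1
  | shift1_0 : TwoStrandRel n (seq (hcomp (one gS) (el .alpha) rfl) psi0 rfl) phi1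
  | shift1_1 : TwoStrandRel n (seq (hcomp (one gS) (el .alpha) rfl) psi1 rfl) (zero gSS gS (0 + 2 + 1))
  | shift2_0 : TwoStrandRel n (seq (hcomp (one gS) (el .gamma) rfl) phi0 rfl) psi1
  | shift2_1 : TwoStrandRel n (seq (hcomp (one gS) (el .gamma) rfl) phi1 rfl) (zero gSS gS (0 + 2 + 1))

/-- The family `E` of relations contains the relations between the graphs `id₂`, `S`, `S ∘ S`. -/
def ContainsTwoStrand (E : Relations n) : Prop :=
  ∀ ⦃a b d⦄ ⦃f g : Term n a b d⦄, TwoStrandRel n f g → E f g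

/-! The remaining relations. -/

theorem isotopic_comp_idn {a : Diagram} {w : Word} (h : a.dom = w) :
    Isotopic (comp a (idn w)) a := h ▸ .symm (.unit_bot a)

theorem isotopic_idn_comp {a : Diagram} {w : Word} (h : a.cod = w) :
    Isotopic (comp (idn w) a) a := h ▸ .symm (.unit_top a)

/-- `v ⊗ (a ∘ b)` and `(v ⊗ a) ∘ (v ⊗ b)` for an identity diagram `v`. -/
theorem isotopic_whiskerLeft (v : Word) {a b : Diagram} (h : a.dom = b.cod) :
    Isotopic (tens (idn v) (comp a b)) (comp (tens (idn v) a) (tens (idn v) b)) :=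
  .trans (.tens (.unit_top (idn v)) (.refl _)) (.exchange _ _ _ _ rfl h)

/-- `(a ∘ b) ⊗ v` and `(a ⊗ v) ∘ (b ⊗ v)` for an identity diagram `v`. -/
theorem isotopic_whiskerRight (v : Word) {a b : Diagram} (h : a.dom = b.cod) :
    Isotopic (tens (comp a b) (idn v)) (comp (tens a (idn v)) (tens b (idn v))) :=
  .trans (.tens (.refl _) (.unit_top (idn v))) (.exchange _ _ _ _ h rfl)

/-- `(ev ∘ coev) ⊗ id₁` is `(ev ⊗ id₁) ∘ (id₁^∨ ⊗ id₂) ∘ (coev ⊗ id₁)`. -/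
theorem isotopic_circle_id1 : Isotopic (tens circle id1) (closeL id2) :=
  .trans (isotopic_whiskerRight _ rfl) (.comp (.refl _)
    (.symm (.trans (.comp (.tens_idn _ _) (.refl _)) (isotopic_idn_comp rfl))))

/-- `ev ∘ coev` is `ev ∘ (id₁^∨ ⊗ id₁) ∘ coev`. -/
theorem isotopic_circle :
    Isotopic circle (comp (ev true) (comp (tens id1' id1) (coev true))) :=
  .comp (.refl _) (.symm (.trans (.comp (.tens_idn _ _) (.refl _)) (isotopic_idn_comp rfl)))

theorem isotopic_nu_left : Isotopic (tens id1 (closeL gS).vrefl) (joinMid id2 (S false)) :=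
  .trans (isotopic_whiskerLeft _ rfl) (.trans (.comp (isotopic_whiskerLeft _ rfl) (.refl _))
    (.trans (.assoc _ _ _) (.comp (.refl _) (.comp
      (.trans (.symm (.tens_assoc _ _ _)) (.tens (.tens_idn _ _) (.refl _))) (.refl _)))))

theorem isotopic_nu_right :
    Isotopic (joinMid gS (idn [false, false])) (tens (closeL gS).hrefl id1') :=
  .symm (.trans (isotopic_whiskerRight _ rfl) (.comp (.tens_assoc _ _ _)
    (.trans (isotopic_whiskerRight _ rfl) (.comp
      (.trans (.tens_assoc _ _ _) (.tens (.refl _) (.tens_idn _ _))) (.tens_assoc _ _ _)))))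

/-- `(S ⊗ id₁) ∘ (id₁ ⊗ S)`. -/
abbrev zorro : Diagram := comp (tens gS id1) (tens id1 gS)

theorem isotopic_zorro : Isotopic zorro (comp zorro (tens id2 id1)) :=
  .symm (.trans (.comp (.refl _) (.tens_idn _ _)) (isotopic_comp_idn rfl))

theorem isotopic_S_id1 : Isotopic (comp (tens gS id1) (tens id1 id2)) (tens gS id1) :=
  .trans (.comp (.refl _) (.tens_idn _ _)) (isotopic_comp_idn rfl)

/-- The component with number `t` of the invertible morphism `g`, in the reflection `x → y`. -/
abbrev cmpt (g : IsoGen) (t : ℕ) (ht : t < g.len n) {x y : Diagram}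
    (h : Reflects g.src (g.tgt t) x y) : Term n x y (g.deg n t) :=
  gen (.fwd g ⟨t, ht⟩) h rfl

/-- The morphism `closeL a → closeL b` induced by `f : a → b`. -/
abbrev closeLMap {a b d} (f : Term n a b d) : Term n (closeL a) (closeL b) d :=
  hcomp (one _) (hcomp (tens (one id1') f (zero_add d).symm) (one _) (add_zero d).symm)
    (zero_add d).symm

/-- The morphism `joinMid a b → joinMid a' b'` induced by `f : a → a'` and `g : b → b'`. -/
abbrev joinMidMap {a a' b b' d e} (f : Term n a a' d) (g : Term n b b' e) :
    Term n (joinMid a b) (joinMid a' b') (d + e) :=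
  hcomp (one _) (hcomp (tens f g rfl) (one _) (add_zero _).symm) (zero_add _).symm

/-- `ε` on the circle. -/
abbrev circleEps : Term n circle circle 2 :=
  seq (seq (isot isotopic_circle)
    (hcomp (one (ev true)) (hcomp (tens (one id1') (el .eps) rfl) (one (coev true)) rfl) rfl) rfl)
    (isot (.symm isotopic_circle)) rfl

/-- The components of `λ ⊗ 1 : (ev ∘ coev) ⊗ id₁ → [n] id₁`. -/
abbrev lamId1 (t : ℕ) (ht : t < n) : Term n (tens circle id1) id1 (IsoGen.lam.deg n t) :=
  seq (Term.tens (cmpt .lam t ht .base) (one id1) (add_zero _).symm)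
    (isot (.symm (.unit_left id1))) (add_zero _).symm

/-- `1 ⊗ χ₀` from `(ev ∘ coev) ⊗ id₁` to the left closure of `S`. -/
abbrev chi0Circle : Term n (tens circle id1) (closeL gS) 1 :=
  seq (isot isotopic_circle_id1) (closeLMap (el .chi0)) rfl

/-- `1 ⊗ χ₁` from the left closure of `S` to `(ev ∘ coev) ⊗ id₁`. -/
abbrev chi1Circle : Term n (closeL gS) (tens circle id1) 1 :=
  seq (closeLMap (el .chi1)) (isot (.symm isotopic_circle_id1)) rfl

/-- `χ₀ ⊗ 1` into the source of `ν`. -/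
abbrev chi0Nu : Term n (tens id1 (closeL gS).vrefl) (joinMid gS (S false)) 1 :=
  seq (isot isotopic_nu_left) (joinMidMap (el .chi0) (one (S false))) rfl

/-- `1 ⊗ χ₁` out of the source of `ν`. -/
abbrev chi1Nu : Term n (joinMid gS (S false)) (tens (closeL gS).hrefl id1') 1 :=
  seq (joinMidMap (one gS) (gen .chi1 (.vrefl .base) rfl)) (isot isotopic_nu_right) rfl

/-- All defining relations of `KR`. The relations between morphisms into direct sums are written in
components; the components of `[m] Γ` are numbered from `0` by increasing shift. -/
inductive KRRel (n : ℕ) : Relations n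
  | twoStrand {a b d} {f g : Term n a b d} : TwoStrandRel n f g → KRRel n f g
  | inv (g : IsoGen) {a b d} {f f' : Term n a b d} : InvRel g f f' → KRRel n f f'
  | moyEps (t : ℕ) (ht : t + 1 < n) : KRRel n
      (seq circleEps (cmpt .lam t (Nat.lt_of_succ_lt ht) .base)
        (by simp only [IsoGen.deg]; push_cast; ring))
      (cmpt .lam (t + 1) ht .base)
  | moyEps_last (t : ℕ) (ht : t + 1 = n) : KRRel n
      (seq circleEps (cmpt .lam t (Nat.lt_of_succ_le ht.le) .base) rfl) (zero _ _ _)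
  | moyChi0 (t : ℕ) (ht : t < n - 1) : KRRel n
      (seq chi0Circle (cmpt .mu t ht .base) (by simp only [IsoGen.deg]; push_cast; ring))
      (lamId1 (t + 1) (Nat.add_lt_of_lt_sub ht))
  | moyChi1 (t : ℕ) (ht : t < n - 1) : KRRel n
      (seq chi1Circle (lamId1 t (ht.trans_le (Nat.sub_le n 1)))
        (by simp only [IsoGen.deg]; ring))
      (cmpt .mu t ht .base)
  | moyChi1_last (t : ℕ) (ht : t + 1 = n) : KRRel n
      (seq chi1Circle (lamId1 t (Nat.lt_of_succ_le ht.le)) rfl) (zero _ _ _)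
  | moyChi0a (t : ℕ) (ht : t < n - 1) : KRRel n
      (seq (closeLMap (el .alpha)) (cmpt .mu t ht .base) rfl) (zero _ _ _)
  | moyChi0b (t : ℕ) (ht : t < n - 1) : KRRel n
      (seq (closeLMap (el .gamma)) (cmpt .mu t ht .base) (add_comm _ _))
      (seq (cmpt .mu t ht .base) (el .eps) rfl)
  | moyZ : KRRel n
      (hcomp (one (tens gS id1)) (tens (one id1) (el .chi0) rfl) rfl)
      (zero (comp (tens gS id1) (tens id1 id2)) zorro (0 + (0 + 1)))
  | moyNu1_zero : KRRel n
      (seq chi0Nu (cmpt .nu 0 (Nat.succ_pos _) .base) rfl) (zero _ _ _)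
  | moyNu1 (t : ℕ) (ht : t < n - 2) : KRRel n
      (seq chi0Nu (cmpt .nu (t + 1) (Nat.succ_lt_succ ht) .base)
        (by simp only [IsoGen.deg]; push_cast; ring))
      (Term.tens (one id1) (cmpt .mu (t + 1) (show t + 1 < n - 1 by omega) (.vrefl .base))
        (zero_add _).symm)
  | moyNu2 (t : ℕ) (ht : t < n - 2) : KRRel n
      (seq chi1Nu (Term.tens (cmpt .mu t (show t < n - 1 by omega) (.hrefl .base)) (one id1')
        (add_zero _).symm) (by simp only [IsoGen.deg]; ring))
      (cmpt .nu (t + 1) (Nat.succ_lt_succ ht) .base)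
  | moyNu2_last (t : ℕ) (ht : t + 2 = n) : KRRel n
      (seq chi1Nu (Term.tens (cmpt .mu t (show t < n - 1 by omega) (.hrefl .base)) (one id1')
        (add_zero _).symm) rfl)
      (zero _ _ _)
  | moyEta_0 : KRRel n
      (seq (seq (isot isotopic_zorro)
        (hcomp (one zorro) (Term.tens (el .chi0) (one id1) rfl) rfl) rfl)
        (cmpt .eta 0 Nat.two_pos .base) rfl)
      (seq (hcomp (one (tens gS id1)) (Term.tens (one id1) (el .chi1) rfl) rfl)
        (isot isotopic_S_id1) rfl)
  | moyEta_1 : KRRel n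
      (seq (seq (isot isotopic_zorro)
        (hcomp (one zorro) (Term.tens (el .chi0) (one id1) rfl) rfl) rfl)
        (cmpt .eta 1 Nat.one_lt_two .base) rfl)
      (zero _ _ _)

theorem TwoStrandRel.contains : ContainsTwoStrand (TwoStrandRel n) := fun _ _ _ _ _ h => h

theorem KRRel.contains : ContainsTwoStrand (KRRel n) := fun _ _ _ _ _ h => .twoStrand h

end relations

/-! ### The category of shifted graphs -/

variable {n : ℕ}

/-- Morphisms of degree `d` modulo the relations. -/
def GHom (E : Relations n) (a b : Diagram) (d : ℤ) : Type :=
  Quot (fun f g : Term n a b d => Cong E f g)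

namespace GHom

variable {E : Relations n} {a b c x y : Diagram} {d e k : ℤ}

def mk (E : Relations n) (f : Term n a b d) : GHom E a b d := Quot.mk _ f

theorem sound {f g : Term n a b d} (h : Cong E f g) : mk E f = mk E g := Quot.sound h

theorem exact {f g : Term n a b d} (h : mk E f = mk E g) : Cong E f g :=
  (Equivalence.eqvGen_iff ⟨.refl, .symm, .trans⟩).1 (Quot.eqvGen_exact h)

instance : Zero (GHom E a b d) := ⟨mk E (.zero a b d)⟩

instance : Add (GHom E a b d) :=
  ⟨Quot.map₂ .add (fun f _ _ h => .add_congr (.refl f) h) (fun _ _ g h => .add_congr h (.refl g))⟩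

instance : Neg (GHom E a b d) := ⟨Quot.map (.smul (-1)) (fun _ _ h => .smul_congr _ h)⟩

instance : AddCommGroup (GHom E a b d) where
  add_assoc := by rintro ⟨f⟩ ⟨g⟩ ⟨h⟩; exact sound (.add_assoc f g h)
  add_comm := by rintro ⟨f⟩ ⟨g⟩; exact sound (.add_comm f g)
  add_zero := by rintro ⟨f⟩; exact sound (.add_zero f)
  zero_add := by rintro ⟨f⟩; exact sound (.trans (.add_comm _ f) (.add_zero f))
  neg_add_cancel := by rintro ⟨f⟩; exact sound (.trans (.add_comm _ f) (.add_neg f))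
  nsmul := nsmulRec
  zsmul := zsmulRec

/-- Composition, in the order of arrows. -/
def seq (f : GHom E a b d) (g : GHom E b c e) (hk : k = d + e) : GHom E a c k :=
  Quot.map₂ (fun f g => Term.seq f g hk) (fun f _ _ h => .seq_congr hk (.refl f) h)
    (fun _ _ g h => .seq_congr hk h (.refl g)) f g

/-- The operation induced by the composition of diagrams. -/
def hcomp (f : GHom E a b d) (g : GHom E x y e) (hk : k = d + e) :
    GHom E (a.comp x) (b.comp y) k :=
  Quot.map₂ (fun f g => Term.hcomp f g hk) (fun f _ _ h => .hcomp_congr hk (.refl f) h)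
    (fun _ _ g h => .hcomp_congr hk h (.refl g)) f g

end GHom

/-- Shifted MOY-type graphs `Γ{m}` with incoming sequence `i` and outgoing sequence `j`. -/
structure ShiftedGraph (E : Relations n) (i j : Word) where
  graph : Diagram
  wf : graph.WellFormed
  dom_eq : graph.dom = i
  cod_eq : graph.cod = j
  shift : ℤ

namespace ShiftedGraph

variable {E : Relations n} {i j : Word}

/-- A morphism `Γ{m} → Γ'{m'}` is a morphism `Γ → Γ'` of degree `m' - m`. -/
instance : Category (ShiftedGraph E i j) where
  Hom X Y := GHom E X.graph Y.graph (Y.shift - X.shift)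
  id X := GHom.mk E (.id X.graph (sub_self _))
  comp f g := f.seq g (by ring)
  id_comp := by rintro X Y ⟨f⟩; exact GHom.sound (.id_seq f _ _)
  comp_id := by rintro X Y ⟨f⟩; exact GHom.sound (.seq_id f _ _)
  assoc := by rintro W X Y Z ⟨f⟩ ⟨g⟩ ⟨h⟩; exact GHom.sound (.seq_assoc f g h _ _ _ _)

instance : Preadditive (ShiftedGraph E i j) where
  homGroup X Y := inferInstanceAs (AddCommGroup (GHom E X.graph Y.graph (Y.shift - X.shift)))
  add_comp := by rintro X Y Z ⟨f⟩ ⟨f'⟩ ⟨g⟩; exact GHom.sound (.add_seq f f' g _)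
  comp_add := by rintro X Y Z ⟨f⟩ ⟨g⟩ ⟨g'⟩; exact GHom.sound (.seq_add f g g' _)

/-- The morphism of shifted graphs given by an expression. -/
def homOf {X Y : ShiftedGraph E i j} (f : Term n X.graph Y.graph (Y.shift - X.shift)) : X ⟶ Y :=
  GHom.mk E f

end ShiftedGraph

/-- Formal direct sums of shifted MOY-type graphs, with matrices of morphisms. -/
abbrev FormalSum (E : Relations n) (i j : Word) := Mat_ (ShiftedGraph E i j)


/-! ### Consequences of the relations that make the complexes below well defined -/

section lemmas

variable {E : Relations n} {a a' b b' c : Diagram} {d e k : ℤ}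

namespace Cong

theorem zero_seq (g : Term n b c e) (hk : k = d + e) :
    Cong E (seq (zero a b d) g hk) (zero a c k) := by
  have h : GHom.mk E (seq (zero a b d) g hk) + GHom.mk E (seq (zero a b d) g hk) =
      GHom.mk E (seq (zero a b d) g hk) + 0 := by
    rw [_root_.add_zero]
    exact GHom.sound (.trans (.symm (.add_seq _ _ g hk)) (.seq_congr hk (.add_zero _) (.refl g)))
  exact GHom.exact (add_left_cancel h)

theorem seq_zero (f : Term n a b d) (hk : k = d + e) :
    Cong E (seq f (zero b c e) hk) (zero a c k) := by
  have h : GHom.mk E (seq f (zero b c e) hk) + GHom.mk E (seq f (zero b c e) hk) =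
      GHom.mk E (seq f (zero b c e) hk) + 0 := by
    rw [_root_.add_zero]
    exact GHom.sound (.trans (.symm (.seq_add f _ _ hk)) (.seq_congr hk (.refl f) (.add_zero _)))
  exact GHom.exact (add_left_cancel h)

theorem hcomp_zero (f : Term n a a' d) (hk : k = d + e) :
    Cong E (hcomp f (zero b b' e) hk) (zero _ _ k) := by
  have h : GHom.mk E (hcomp f (zero b b' e) hk) + GHom.mk E (hcomp f (zero b b' e) hk) =
      GHom.mk E (hcomp f (zero b b' e) hk) + 0 := by
    rw [_root_.add_zero]
    exact GHom.sound (.trans (.symm (.hcomp_add f _ _ hk))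
      (.hcomp_congr hk (.refl f) (.add_zero _)))
  exact GHom.exact (add_left_cancel h)

theorem assocR {l k₁} (f : Term n a b d) (g : Term n b c e) (h : Term n c a' l)
    (h₁ : k₁ = d + e) (h₂ : k = k₁ + l) :
    Cong E (seq (seq f g h₁) h h₂) (seq f (seq g h rfl) (by omega)) :=
  .seq_assoc f g h h₁ h₂ rfl _

theorem assocL {l k₂} (f : Term n a b d) (g : Term n b c e) (h : Term n c a' l)
    (h₃ : k₂ = e + l) (h₄ : k = d + k₂) :
    Cong E (seq f (seq g h h₃) h₄) (seq (seq f g rfl) h (by omega)) :=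
  .symm (.seq_assoc f g h rfl _ h₃ h₄)

theorem unit_top_slide {z w k₂} (f : Term n a b d) (ha : Isotopic a (comp (idn w) a))
    (hb : Isotopic b (comp (idn w) b)) (hz : z = 0) (h₁ : k = d + z) (h₂ : k₂ = z + d)
    (h₃ : k = z + k₂) :
    Cong E (seq f (iso hb hz) h₁) (seq (iso ha hz) (hcomp (id (idn w) hz) f h₂) h₃) := by
  obtain rfl : k₂ = d := by omega
  obtain rfl : k = k₂ := by omega
  exact .unit_top f ha hb hz h₁ h₂

/-- `f ∘ g` as `1 ∘ g` followed by `f ∘ 1`. -/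
theorem hcomp_left {z k₁ k₂} (f : Term n a a' d) (g : Term n b b' e) (hz : z = 0)
    (h₁ : k₁ = z + e) (h₂ : k₂ = d + z) (h₃ : k = k₁ + k₂) (h₄ : k = d + e)
    (h₅ : d = z + d := by omega) (h₆ : e = e + z := by omega) :
    Cong E (seq (hcomp (id a hz) g h₁) (hcomp f (id b' hz) h₂) h₃) (hcomp f g h₄) :=
  .trans (.hcomp_seq _ _ _ _ h₁ h₂ h₃ h₅ h₆ h₄) (.hcomp_congr h₄ (.id_seq f hz h₅) (.seq_id g hz h₆))

/-- `f ∘ g` as `f ∘ 1` followed by `1 ∘ g`. -/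
theorem hcomp_right {z k₁ k₂} (f : Term n a a' d) (g : Term n b b' e) (hz : z = 0)
    (h₁ : k₁ = d + z) (h₂ : k₂ = z + e) (h₃ : k = k₁ + k₂) (h₄ : k = d + e)
    (h₅ : d = d + z := by omega) (h₆ : e = z + e := by omega) :
    Cong E (seq (hcomp f (id b hz) h₁) (hcomp (id a' hz) g h₂) h₃) (hcomp f g h₄) :=
  .trans (.hcomp_seq _ _ _ _ h₁ h₂ h₃ h₅ h₆ h₄) (.hcomp_congr h₄ (.seq_id f hz h₅) (.id_seq g hz h₆))

end Cong

/-- `χ₀ : id₂ → S{1}`. -/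
abbrev tChi0 (hd : d = 1) : Term n id2 gS d := gen .chi0 .base hd

/-- `α` if `j` is even, and `γ` if `j` is odd, as morphisms `S → S{2}`. -/
def tAG : ∀ (_ : ℕ) (_ : d = 2), Term n gS gS d
  | 0, hd => gen .alpha .base hd
  | 1, hd => gen .gamma .base hd
  | j + 2, hd => tAG j hd

/-- `χ₀ ∘ 1 : S → S ∘ S{1}`. -/
abbrev tTop (hd : d = 1) : Term n gS gSS d :=
  seq (isot (.unit_top gS)) (hcomp (el .chi0) (one gS) rfl) hd

/-- `1 ∘ χ₀ : S → S ∘ S{1}`. -/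
abbrev tBot (hd : d = 1) : Term n gS gSS d :=
  seq (isot (.unit_bot gS)) (hcomp (one gS) (el .chi0) rfl) hd

/-- `1 ∘ f : S ∘ S → S ∘ S{d}` for `f : S → S{d}`. -/
abbrev tRight (f : Term n gS gS d) : Term n gSS gSS d := hcomp (one gS) f (zero_add d).symm

/-- `χ₀ ∘ 1 : id₂ → id₂ ∘ id₂ → S ∘ id₂{1} → S{1}`. -/
abbrev tLeft (hd : d = 1) : Term n id2 gS d :=
  seq (isot (.unit_top id2))
    (seq (hcomp (el .chi0) (one id2) rfl) (isot (.symm (.unit_bot gS))) rfl) hd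

namespace Cong

/-- `(χ₀ ∘ 1) g = (1 ∘ g) (χ₀ ∘ 1)`. -/
theorem top_slide (g : Term n gS gS e) (hd : d = 1) (hk : k = e + d) (hk' : k = d + e) :
    Cong E (seq g (tTop hd) hk) (seq (tTop hd) (tRight g) hk') := by
  subst hd
  refine .trans (assocL _ _ _ _ _) ?_
  refine .trans (.seq_congr _ (unit_top_slide g (.unit_top gS) _ rfl _ rfl (by omega)) (.refl _)) ?_
  refine .trans (.seq_assoc (k₂ := k) _ _ _ _ _ (by omega) (by omega)) ?_
  refine .trans ?_ (.symm (.seq_assoc (k₂ := k) _ _ _ _ _ (by omega) (by omega)))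
  exact .seq_congr _ (.refl _) (.trans (hcomp_left _ _ rfl _ _ _ hk')
    (.symm (hcomp_right _ _ rfl _ _ _ hk')))

theorem top_tAG {d' e'} (j : ℕ) (h₁ : e = 2) (h₂ : d = 1) (h₃ : d' = 1) (h₄ : e' = 2)
    (hk : k = e + d) (hk' : k = d' + e') :
    Cong E (seq (tAG j h₁) (tTop h₂) hk) (seq (tTop h₃) (tRight (tAG j h₄)) hk') := by
  obtain rfl : e = e' := by omega
  obtain rfl : d = d' := by omega
  exact top_slide _ h₂ hk hk'

/-- `(χ₀ ∘ 1) χ₀ = (1 ∘ χ₀) (χ₀ ∘ 1)`. -/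
theorem left_bot (h₁ : d = 1) (h₂ : e = 1) (hk : k = d + e) :
    Cong E (seq (tChi0 h₁) (tTop h₂) hk) (seq (tLeft h₁) (tBot h₂) hk) := by
  subst h₁ h₂ hk
  refine .trans (assocL _ _ _ _ _) ?_
  refine .trans (.seq_congr _ (unit_top_slide _ (.unit_top id2) _ rfl _ rfl rfl) (.refl _)) ?_
  refine .trans (assocR _ _ _ _ _) ?_
  refine .trans ?_ (.symm (assocR _ _ _ _ _))
  refine .seq_congr _ (.refl _) ?_
  refine .trans (hcomp_left _ _ rfl _ _ _ rfl) ?_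
  refine .trans (.symm (hcomp_right (k₁ := 1) (k₂ := 1) _ _ rfl rfl rfl rfl _)) ?_
  refine .trans ?_ (.symm (assocR _ _ _ _ _))
  refine .seq_congr _ (.refl _) ?_
  refine .trans ?_ (.symm (assocL _ _ _ _ _))
  refine .symm (.trans (.seq_congr _ (.iso_seq _ _ (.refl _) rfl rfl rfl rfl) (.refl _)) ?_)
  exact .trans (.seq_congr _ (.iso_self _ rfl) (.refl _)) (.id_seq _ rfl _)

theorem chi0_alpha (hE : ContainsTwoStrand E)
    (h₁ : d = 1) (h₂ : e = 2) (hk : k = d + e) :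
    Cong E (seq (tChi0 h₁) (tAG 0 h₂) hk) (zero _ _ _) := by
  subst h₁ h₂ hk
  refine .trans (.seq_congr _ (.refl _) (.of (hE .alpha_eq))) ?_
  refine .trans (assocL _ _ _ _ _) ?_
  refine .trans (.seq_congr _ (left_bot rfl rfl rfl) (.refl _)) ?_
  refine .trans (assocR _ _ _ _ _) (.trans (.seq_congr _ (.refl _) ?_) (seq_zero _ _))
  refine .trans (assocR _ _ _ _ _) (.trans (.seq_congr _ (.refl _) ?_) (seq_zero _ _))
  refine .trans (assocL _ _ _ _ _) ?_
  refine .trans (.seq_congr _ (.trans (.hcomp_seq _ _ _ _ _ _ _ rfl rfl rfl) ?_) (.refl _))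
    (zero_seq _ _)
  exact .trans (.hcomp_congr _ (.refl _) (.of (hE .chi1_chi0))) (hcomp_zero _ _)

theorem alpha_gamma (hE : ContainsTwoStrand E)
    (h₁ : d = 2) (h₂ : e = 2) (hk : k = d + e) :
    Cong E (seq (tAG 0 h₁) (tAG 1 h₂) hk) (zero _ _ _) := by
  subst h₁ h₂ hk
  refine .trans (.seq_congr _ (.refl _) (.symm (.of (hE .moy2c_1)))) ?_
  refine .trans (assocL _ _ _ _ _) ?_
  refine .trans (.seq_congr _ (top_slide _ rfl _ rfl) (.refl _)) ?_
  refine .trans (assocR _ _ _ _ _) (.trans (.seq_congr _ (.refl _) ?_) (seq_zero _ _))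
  exact .of (hE .shift1_1)

theorem gamma_alpha (hE : ContainsTwoStrand E)
    (h₁ : d = 2) (h₂ : e = 2) (hk : k = d + e) :
    Cong E (seq (tAG 1 h₁) (tAG 0 h₂) hk) (zero _ _ _) := by
  subst h₁ h₂ hk
  refine .trans (.seq_congr _ (.refl _) (.symm (.of (hE .moy2b_1)))) ?_
  refine .trans (assocL _ _ _ _ _) ?_
  refine .trans (.seq_congr _ (top_slide _ rfl _ rfl) (.refl _)) ?_
  refine .trans (assocR _ _ _ _ _) (.trans (.seq_congr _ (.refl _) ?_) (seq_zero _ _))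
  exact .of (hE .shift2_1)

theorem tAG_tAG (hE : ContainsTwoStrand E) : ∀ (j : ℕ) (h₁ : d = 2) (h₂ : e = 2) (hk : k = d + e),
    Cong E (seq (tAG j h₁) (tAG (j + 1) h₂) hk) (zero _ _ _)
  | 0, h₁, h₂, hk => alpha_gamma hE h₁ h₂ hk
  | 1, h₁, h₂, hk => gamma_alpha hE h₁ h₂ hk
  | j + 2, h₁, h₂, hk => tAG_tAG hE j h₁ h₂ hk

theorem bot_alpha (hE : ContainsTwoStrand E)
    (h₁ : d = 1) (h₂ : e = 2) (hk : k = d + e) :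
    Cong E (seq (tBot h₁) (tRight (tAG 0 h₂)) hk) (zero _ _ _) := by
  subst h₁ h₂ hk
  refine .trans (assocR _ _ _ _ _) (.trans (.seq_congr _ (.refl _) ?_) (seq_zero _ _))
  refine .trans (.hcomp_seq _ _ _ _ _ _ _ rfl rfl rfl) ?_
  exact .trans (.hcomp_congr _ (.refl _) (chi0_alpha hE rfl rfl rfl)) (hcomp_zero _ _)

theorem right_right (hE : ContainsTwoStrand E)
    (j : ℕ) (h₁ : d = 2) (h₂ : e = 2) (hk : k = d + e) :
    Cong E (seq (tRight (tAG j h₁)) (tRight (tAG (j + 1) h₂)) hk) (zero _ _ _) := by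
  subst h₁ h₂ hk
  refine .trans (.hcomp_seq _ _ _ _ _ _ _ rfl rfl rfl) ?_
  exact .trans (.hcomp_congr _ (.refl _) (tAG_tAG hE j rfl rfl rfl)) (hcomp_zero _ _)

end Cong

end lemmas

/-! ### Formal complexes and their equivalence -/

section complexes

variable {C : Type*} [Category C] [Preadditive C]

/-- A complex is bounded if all but finitely many of its terms are zero. -/
def Bounded (K : CochainComplex C ℤ) : Prop :=
  ∃ lo hi : ℤ, ∀ i, i < lo ∨ hi < i → IsZero (K.X i)

variable [HasBinaryBiproducts C]

/-- `K` is of the form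
`⋯ → L_{p-1} → N ⊞ L_p → N ⊞ L_{p+1} → L_{p+2} → ⋯` with differentials
`(β, A)`, `(1, α; 0, A)`, `(0, A)` at the places shown and those of `L` elsewhere, up to a choice of
isomorphisms of the terms (in particular, of the direct sums `N ⊞ L_p` and `N ⊞ L_{p+1}`). -/
structure CancelSub (K L : CochainComplex C ℤ) where
  p : ℤ
  N : C
  beta : L.X (p - 1) ⟶ N
  alpha : L.X p ⟶ N
  e : ∀ i, i ≠ p → i ≠ p + 1 → (K.X i ≅ L.X i)
  e₀ : K.X p ≅ N ⊞ L.X p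
  e₁ : K.X (p + 1) ≅ N ⊞ L.X (p + 1)
  comm : ∀ i j hi hi' hj hj', K.d i j ≫ (e j hj hj').hom = (e i hi hi').hom ≫ L.d i j
  comm_in : K.d (p - 1) p ≫ e₀.hom =
    (e (p - 1) (by omega) (by omega)).hom ≫ biprod.lift beta (L.d (p - 1) p)
  comm_mid : K.d p (p + 1) ≫ e₁.hom =
    e₀.hom ≫ Biprod.ofComponents (𝟙 N) 0 alpha (L.d p (p + 1))
  comm_out : K.d (p + 1) (p + 2) ≫ (e (p + 2) (by omega) (by omega)).hom =
    e₁.hom ≫ biprod.desc 0 (L.d (p + 1) (p + 2))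

/-- `K` is of the form
`⋯ → L_{p-1} → L_p ⊞ N → L_{p+1} ⊞ N → L_{p+2} → ⋯` with differentials
`(A, 0)`, `(A, α; 0, 1)`, `(A, β)` at the places shown and those of `L` elsewhere, up to a choice of
isomorphisms of the terms (in particular, of the direct sums `L_p ⊞ N` and `L_{p+1} ⊞ N`). -/
structure CancelQuot (K L : CochainComplex C ℤ) where
  p : ℤ
  N : C
  alpha : N ⟶ L.X (p + 1)
  beta : N ⟶ L.X (p + 2)
  e : ∀ i, i ≠ p → i ≠ p + 1 → (K.X i ≅ L.X i)
  e₀ : K.X p ≅ L.X p ⊞ N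
  e₁ : K.X (p + 1) ≅ L.X (p + 1) ⊞ N
  comm : ∀ i j hi hi' hj hj', K.d i j ≫ (e j hj hj').hom = (e i hi hi').hom ≫ L.d i j
  comm_in : K.d (p - 1) p ≫ e₀.hom =
    (e (p - 1) (by omega) (by omega)).hom ≫ biprod.lift (L.d (p - 1) p) 0
  comm_mid : K.d p (p + 1) ≫ e₁.hom =
    e₀.hom ≫ Biprod.ofComponents (L.d p (p + 1)) 0 alpha (𝟙 N)
  comm_out : K.d (p + 1) (p + 2) ≫ (e (p + 2) (by omega) (by omega)).hom =
    e₁.hom ≫ biprod.desc (L.d (p + 1) (p + 2)) beta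

/-- The equivalence relation on bounded complexes generated by isomorphisms of complexes and by the
cancellation of a subcomplex or of a quotient complex `N → N` with differential `1`. The morphisms
of the category `KR` are the equivalence classes of formal complexes. -/
def Equivalent : {K : CochainComplex C ℤ // Bounded K} → {K : CochainComplex C ℤ // Bounded K} →
    Prop :=
  Relation.EqvGen fun K L =>
    Nonempty (K.1 ≅ L.1) ∨ Nonempty (CancelSub K.1 L.1) ∨ Nonempty (CancelQuot K.1 L.1)

/-- The term in degree `i` of the total complex of a bicomplex with two rows. -/
noncomputable abbrev totX (K L : CochainComplex C ℤ) (i : ℤ) : C := K.X i ⊞ L.X (i - 1)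

/-- The differential of the total complex of a bicomplex with two rows: the horizontal differentials
and `(-1)ⁱ` times the vertical one. -/
noncomputable def totD {K L : CochainComplex C ℤ} (f : K ⟶ L) (i : ℤ) :
    totX K L i ⟶ totX K L (i + 1) :=
  Biprod.ofComponents (K.d i (i + 1))
    ((Int.negOnePow i : ℤ) • (f.f i ≫ (L.XIsoOfEq (add_sub_cancel_right i 1).symm).hom))
    0 (L.d (i - 1) (i + 1 - 1))

theorem totD_comp {K L : CochainComplex C ℤ} (f : K ⟶ L) (i : ℤ) :
    totD f i ≫ totD f (i + 1) = 0 := by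
  simp only [totD]
  rw [Biprod.ofComponents_comp]
  apply biprod.hom_ext'
  · have h : ∀ {j k : ℤ} (hj : j = k) {Z : C} (g : L.X k ⟶ Z),
        K.d i j ≫ f.f j ≫ (L.XIsoOfEq hj).hom ≫ g = K.d i k ≫ f.f k ≫ g := by
      rintro j _ rfl Z g
      simp
    simp [Int.negOnePow_succ, HomologicalComplex.XIsoOfEq_hom_comp_d, h]
  · simp

/-- The total complex of the bicomplex with rows `K` (in vertical degree `0`) and `L` (in vertical
degree `1`), and with vertical maps `f`. -/
noncomputable def tot {K L : CochainComplex C ℤ} (f : K ⟶ L) : CochainComplex C ℤ :=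
  CochainComplex.of (totX K L) (totD f) (totD_comp f)

theorem Bounded.tot {K L : CochainComplex C ℤ} (hK : Bounded K) (hL : Bounded L) (f : K ⟶ L) :
    Bounded (tot f) := by
  obtain ⟨a, b, h⟩ := hK
  obtain ⟨a', b', h'⟩ := hL
  refine ⟨min a a', max b (b' + 1), fun i hi => ?_⟩
  refine (IsZero.iff_id_eq_zero _).2 (biprod.hom_ext _ _ ?_ ?_)
  · exact (h i (by omega)).eq_of_tgt _ _
  · exact (h' (i - 1) (by omega)).eq_of_tgt _ _

end complexes

section rows

variable {C : Type*} [Category C] [Preadditive C] {G H : ℕ → C}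

/-- The family `G` extended to all integers; the values at negative integers are irrelevant. -/
def extObj (G : ℕ → C) : ℤ → C
  | .ofNat j => G j
  | .negSucc _ => G 0

/-- The maps `D` extended by zero to all integers. -/
def extD (D : ∀ j, G j ⟶ G (j + 1)) : ∀ i : ℤ, extObj G i ⟶ extObj G (i + 1)
  | .ofNat j => D j
  | .negSucc _ => 0

/-- The maps `v` extended by zero to all integers. -/
def extV (v : ∀ j, G j ⟶ H j) : ∀ i : ℤ, extObj G i ⟶ extObj H i
  | .ofNat j => v j
  | .negSucc _ => 0

theorem extD_comp {D : ∀ j, G j ⟶ G (j + 1)} (hD : ∀ j, D j ≫ D (j + 1) = 0) :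
    ∀ i : ℤ, extD D i ≫ extD D (i + 1) = 0
  | .ofNat j => hD j
  | .negSucc _ => zero_comp

theorem extV_comm {D : ∀ j, G j ⟶ G (j + 1)} {D' : ∀ j, H j ⟶ H (j + 1)} {v : ∀ j, G j ⟶ H j}
    (hv : ∀ j, v j ≫ D' j = D j ≫ v (j + 1)) :
    ∀ i : ℤ, extV v i ≫ extD D' i = extD D i ≫ extV v (i + 1)
  | .ofNat j => hv j
  | .negSucc _ => zero_comp.trans zero_comp.symm

/-- `G i` if `0 ≤ i ≤ m`, and the zero object otherwise. -/
noncomputable def rowX (G : ℕ → C) (m : ℕ) (i : ℤ) : Mat_ C where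
  ι := PLift (0 ≤ i ∧ i ≤ m)
  fintype := Fintype.ofFinite _
  X _ := extObj G i

/-- The map of one-entry matrices `D i`, or the zero map of an empty matrix. -/
noncomputable def rowD (D : ∀ j, G j ⟶ G (j + 1)) (m : ℕ) (i : ℤ) : rowX G m i ⟶ rowX G m (i + 1) :=
  fun _ _ => extD D i

/-- The map of one-entry matrices `v i`, or the zero map of an empty matrix. -/
noncomputable def rowV (v : ∀ j, G j ⟶ H j) (m : ℕ) (i : ℤ) : rowX G m i ⟶ rowX H m i :=
  fun _ _ => extV v i

theorem rowD_comp {D : ∀ j, G j ⟶ G (j + 1)} (hD : ∀ j, D j ≫ D (j + 1) = 0) (m : ℕ) (i : ℤ) :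
    rowD D m i ≫ rowD D m (i + 1) = 0 := by
  apply Mat_.hom_ext
  intro x y
  exact Finset.sum_eq_zero fun z _ => extD_comp hD i

theorem rowV_comm {D : ∀ j, G j ⟶ G (j + 1)} {D' : ∀ j, H j ⟶ H (j + 1)} {v : ∀ j, G j ⟶ H j}
    (hv : ∀ j, v j ≫ D' j = D j ≫ v (j + 1)) (m : ℕ) (i : ℤ) :
    rowV v m i ≫ rowD D' m i = rowD D m i ≫ rowV v m (i + 1) := by
  apply Mat_.hom_ext
  intro x y
  have h₁ : Subsingleton (rowX H m i).ι := inferInstanceAs (Subsingleton (PLift _))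
  have h₂ : Subsingleton (rowX G m (i + 1)).ι := inferInstanceAs (Subsingleton (PLift _))
  have e₁ : (rowV v m i ≫ rowD D' m i) x y = extV v i ≫ extD D' i :=
    Fintype.sum_subsingleton (fun z : (rowX H m i).ι => rowV v m i x z ≫ rowD D' m i z y) x
  have e₂ : (rowD D m i ≫ rowV v m (i + 1)) x y = extD D i ≫ extV v (i + 1) :=
    Fintype.sum_subsingleton
      (fun z : (rowX G m (i + 1)).ι => rowD D m i x z ≫ rowV v m (i + 1) z y) y
  exact e₁.trans ((extV_comm hv i).trans e₂.symm)

/-- The complex `G 0 → G 1 → ⋯ → G m`, with `G 0` in degree `0`. -/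
noncomputable def row (D : ∀ j, G j ⟶ G (j + 1)) (hD : ∀ j, D j ≫ D (j + 1) = 0) (m : ℕ) :
    CochainComplex (Mat_ C) ℤ :=
  CochainComplex.of (rowX G m) (rowD D m) (rowD_comp hD m)

theorem row_bounded (D : ∀ j, G j ⟶ G (j + 1)) (hD : ∀ j, D j ≫ D (j + 1) = 0) (m : ℕ) :
    Bounded (row D hD m) := by
  refine ⟨0, m, fun i hi => (IsZero.iff_id_eq_zero _).2 ?_⟩
  apply Mat_.hom_ext
  intro x y
  exact absurd x.down (by omega)

/-- The morphism of complexes with components `v 0, …, v m`. -/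
noncomputable def rowMap {D : ∀ j, G j ⟶ G (j + 1)} {hD : ∀ j, D j ≫ D (j + 1) = 0}
    {D' : ∀ j, H j ⟶ H (j + 1)} {hD' : ∀ j, D' j ≫ D' (j + 1) = 0} (v : ∀ j, G j ⟶ H j)
    (hv : ∀ j, v j ≫ D' j = D j ≫ v (j + 1)) (m : ℕ) : row D hD m ⟶ row D' hD' m :=
  CochainComplex.ofHom (X := row D hD m) (Y := row D' hD' m) (rowV v m) (fun i => by
    dsimp only [row, CochainComplex.of]
    rw [CochainComplex.of_d, CochainComplex.of_d]
    exact rowV_comm hv m i)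

end rows


/-! ### The two rows -/

section main

variable (E : Relations n)

/-- `Γ{m}` for a graph `Γ` from `↑↑` to `↑↑`. -/
abbrev Obj2 := ShiftedGraph E [true, true] [true, true]

/-- The graphs `id₂, S{1}, S{3}, S{5}, …`. -/
def topG : ℕ → Obj2 E
  | 0 => ⟨id2, trivial, rfl, rfl, 0⟩
  | j + 1 => ⟨gS, trivial, rfl, rfl, 2 * j + 1⟩

/-- The graphs `S{1}, S ∘ S{2}, S ∘ S{4}, S ∘ S{6}, …`. -/
def botG : ℕ → Obj2 E
  | 0 => ⟨gS, trivial, rfl, rfl, 1⟩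
  | j + 1 => ⟨gSS, ⟨trivial, trivial, rfl⟩, rfl, rfl, 2 * j + 2⟩

/-- The maps `χ₀, α, γ, α, γ, …`. -/
def topD : ∀ j, topG E j ⟶ topG E (j + 1)
  | 0 => ShiftedGraph.homOf (tChi0 (by simp [topG]))
  | j + 1 => ShiftedGraph.homOf (tAG j (by simp only [topG]; push_cast; ring))

/-- The maps `1 ∘ χ₀, 1 ∘ α, 1 ∘ γ, 1 ∘ α, 1 ∘ γ, …`. -/
def botD : ∀ j, botG E j ⟶ botG E (j + 1)
  | 0 => ShiftedGraph.homOf (tBot (by simp [botG]))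
  | j + 1 => ShiftedGraph.homOf (tRight (tAG j (by simp only [botG]; push_cast; ring)))

/-- The maps `χ₀ ∘ 1`. -/
def vert : ∀ j, topG E j ⟶ botG E j
  | 0 => ShiftedGraph.homOf (tLeft (by simp [topG, botG]))
  | j + 1 => ShiftedGraph.homOf (tTop (by simp only [topG, botG]; ring))

theorem vert_comm : ∀ j, vert E j ≫ botD E j = topD E j ≫ vert E (j + 1)
  | 0 => GHom.sound (.symm (.left_bot _ _ _))
  | _ + 1 => GHom.sound (.symm (.top_tAG _ _ _ _ _ _ _))

variable {E}

theorem topD_comp (hE : ContainsTwoStrand E) : ∀ j, topD E j ≫ topD E (j + 1) = 0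
  | 0 => GHom.sound (.chi0_alpha hE _ _ _)
  | j + 1 => GHom.sound (.tAG_tAG hE j _ _ _)

theorem botD_comp (hE : ContainsTwoStrand E) : ∀ j, botD E j ≫ botD E (j + 1) = 0
  | 0 => GHom.sound (.bot_alpha hE _ _ _)
  | j + 1 => GHom.sound (.right_right hE j _ _ _)

end main

instance {C : Type*} [Category C] [Preadditive C] : HasBinaryBiproducts (Mat_ C) :=
  hasBinaryBiproducts_of_finite_biproducts _

/-- Bounded formal complexes of formal direct sums of shifted graphs, with morphisms modulo the
relations `E`. -/
abbrev FormalComplex (E : Relations n) (i j : Word) :=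
  {K : CochainComplex (FormalSum E i j) ℤ // Bounded K}

/-- The complex `id₂ → S{1} → S{3} → ⋯ → S{2m-1}` with maps `χ₀, α, γ, α, γ, …`. -/
noncomputable def mainComplex (E : Relations n) (hE : ContainsTwoStrand E) (m : ℕ) :
    FormalComplex E [true, true] [true, true] :=
  ⟨row (topD E) (topD_comp hE) m, row_bounded _ _ _⟩

/-- The total complex of the bicomplex with top row `id₂ → S{1} → S{3} → ⋯ → S{2m-1}`, with bottom
row `S{1} → S ∘ S{2} → S ∘ S{4} → ⋯ → S ∘ S{2m}` with maps `1 ∘ χ₀, 1 ∘ α, 1 ∘ γ, …`, and with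
vertical maps `χ₀ ∘ 1`. -/
noncomputable def totalComplex (E : Relations n) (hE : ContainsTwoStrand E) (m : ℕ) :
    FormalComplex E [true, true] [true, true] :=
  ⟨tot (rowMap (hD := topD_comp hE) (hD' := botD_comp hE) (vert E) (vert_comm E) m),
    (row_bounded _ _ _).tot (row_bounded _ _ _) _⟩

end KR

/-!
The bottom row of the bicomplex decomposes. The isomorphisms `φ` (in odd columns) and `ψ` (in even
columns) identify its term `S ∘ S{2j}` with `S{2j-1} ⊕ S{2j+1}`, and the relations say that in these
coordinates

* the vertical map `χ₀ ∘ 1 : S{2j-1} → S ∘ S{2j}` is `(1, α)` or `(1, γ)`, the second entry being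
  the horizontal map of the top row;
* the horizontal map of the bottom row carries the second summand `S{2j+1}` of one term identically
  to the first summand of the next term, and kills the first summand.

Such data are called an `Elimination`; `rowElimination` is the one at hand. In the total complex,
each term `S{2j-1}` of the top row can therefore be cancelled against the first summand of the
term below it. The terms that survive are `id₂` and the second summands `S{2j+1}`, among them the
first term `S{1}` of the bottom row, and the maps induced between them are those of the top row,
up to sign: the part of the differential that connects two consecutive second summands after the
cancellation is the zigzag through a cancelled pair, which is the entry `α` or `γ` of the vertical
map. This is the row with one more term.

The cancellation is carried out at once. `Elimination.incl` and `Elimination.proj` make the longer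
row a retract of the total complex (`coneCx`, a form of it without signs), and
`Elimination.total_eq` shows that the complement is the sum of the complexes `N → N` with
differential `1`, for `N` the cancelled terms. That this gives an equivalence in the sense of the
generating moves, which remove one such summand at a time, is `equivalent_of_retract`.
Only the relations between `id₂`, `S` and `S ∘ S` enter, so the argument applies to every family of
relations that contains these.
-/

namespace KR

/-! ### Splitting off complexes `N → N` -/

section splitting

variable {C : Type*} [Category C] [Preadditive C]

theorem Bounded.of_retract {K L : CochainComplex C ℤ} (hK : Bounded K) (u : L ⟶ K) (v : K ⟶ L)
    (huv : u ≫ v = 𝟙 L) : Bounded L := by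
  obtain ⟨a, b, h⟩ := hK
  refine ⟨a, b, fun i hi => (IsZero.iff_id_eq_zero _).2 ?_⟩
  rw [← HomologicalComplex.id_f, ← huv, HomologicalComplex.comp_f, (h i hi).eq_zero_of_tgt (u.f i),
    zero_comp]

/-- If `L` is a retract of `K` and the complement is `N → N` with differential `1`, in degrees `p`
and `p + 1`, then `L` arises from `K` by cancellation. -/
noncomputable def CancelSub.ofRetract [HasBinaryBiproducts C] {K L : CochainComplex C ℤ}
    (u : L ⟶ K) (v : K ⟶ L) (huv : u ≫ v = 𝟙 L) (p : ℤ) (N : C) (x : N ⟶ K.X p)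
    (y : K.X (p + 1) ⟶ N) (hxy : x ≫ K.d p (p + 1) ≫ y = 𝟙 N) (hx : x ≫ v.f p = 0)
    (hy : u.f (p + 1) ≫ y = 0) (h : ∀ i, i ≠ p → i ≠ p + 1 → v.f i ≫ u.f i = 𝟙 _)
    (h₀ : v.f p ≫ u.f p + K.d p (p + 1) ≫ y ≫ x = 𝟙 _)
    (h₁ : v.f (p + 1) ≫ u.f (p + 1) + y ≫ x ≫ K.d p (p + 1) = 𝟙 _) : CancelSub K L :=
  have huv' (i) : u.f i ≫ v.f i = 𝟙 _ := by rw [← HomologicalComplex.comp_f, huv]; rfl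
  { p := p
    N := N
    beta := 0
    alpha := 0
    e := fun i hi hi' => ⟨v.f i, u.f i, h i hi hi', huv' i⟩
    e₀ :=
      { hom := biprod.lift (K.d p (p + 1) ≫ y) (v.f p)
        inv := biprod.desc x (u.f p)
        hom_inv_id := by
          rw [biprod.lift_desc, ← h₀, add_comm, Category.assoc]
        inv_hom_id := by
          apply biprod.hom_ext' <;> apply biprod.hom_ext
          · simpa using hxy
          · simpa using hx
          · simp [hy]
          · simpa using huv' p }
    e₁ :=
      { hom := biprod.lift y (v.f (p + 1))
        inv := biprod.desc (x ≫ K.d p (p + 1)) (u.f (p + 1))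
        hom_inv_id := by rw [biprod.lift_desc, ← h₁]; exact add_comm _ _
        inv_hom_id := by
          apply biprod.hom_ext' <;> apply biprod.hom_ext
          · simpa using hxy
          · simpa using by rw [← v.comm, ← Category.assoc, hx, zero_comp]
          · simpa using hy
          · simpa using huv' (p + 1) }
    comm := fun i j _ _ _ _ => (v.comm i j).symm
    comm_in := by
      apply biprod.hom_ext
      · simp
      · simp
    comm_mid := by
      apply biprod.hom_ext
      · simp [Biprod.ofComponents]
      · simp [Biprod.ofComponents]
    comm_out := by
      simp }

theorem up_rel (p : ℤ) : (ComplexShape.up ℤ).Rel p (p + 1) := rfl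

/-- The complex `N → N` with differential `1`, in degrees `p` and `p + 1`. -/
noncomputable abbrev disk [HasZeroObject C] (N : C) (p : ℤ) : CochainComplex C ℤ :=
  HomologicalComplex.double (𝟙 N) (i₀ := p) (i₁ := p + 1) (up_rel p)

section disk

open HomologicalComplex

variable [HasZeroObject C] {N : C} {p : ℤ} {K : CochainComplex C ℤ}

/-- The morphism out of `N → N` determined by its component in the lower degree. -/
noncomputable def fromDisk (x : N ⟶ K.X p) : disk N p ⟶ K :=
  mkHomFromDouble (up_rel p) (by omega) x (x ≫ K.d p (p + 1)) (by simp) (by simp)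

/-- The morphism into `N → N` determined by its component in the upper degree. -/
noncomputable def toDisk (y : K.X (p + 1) ⟶ N) : K ⟶ disk N p where
  f k := if h : k = p then
      (K.XIsoOfEq h).hom ≫ (K.d p (p + 1) ≫ y) ≫ (doubleXIso₀ (𝟙 N) (up_rel _)).inv ≫
        ((disk N p).XIsoOfEq h).inv
    else if h : k = p + 1 then
      (K.XIsoOfEq h).hom ≫ y ≫ (doubleXIso₁ (𝟙 N) (up_rel _) (by omega)).inv ≫
        ((disk N p).XIsoOfEq h).inv
    else 0
  comm' i j hij := by
    obtain rfl : i + 1 = j := hij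
    by_cases h₁ : i = p
    · subst h₁
      rw [dif_pos rfl, dif_neg (by omega), dif_pos rfl, double_d _ (up_rel _) (by omega)]
      simp
    · rw [double_d_eq_zero₀ _ (up_rel _) _ _ h₁, comp_zero]
      by_cases h₂ : i + 1 = p
      · subst h₂
        simp
      · rw [dif_neg h₂, dif_neg (by omega), comp_zero]

@[simp]
theorem fromDisk_f₀ (x : N ⟶ K.X p) :
    (fromDisk x).f p = (doubleXIso₀ (𝟙 N) (up_rel _)).hom ≫ x :=
  mkHomFromDouble_f₀ ..

@[simp]
theorem fromDisk_f₁ (x : N ⟶ K.X p) :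
    (fromDisk x).f (p + 1) = (doubleXIso₁ (𝟙 N) (up_rel _) (by omega)).hom ≫ x ≫ K.d p (p + 1) :=
  mkHomFromDouble_f₁ ..

@[simp]
theorem toDisk_f₀ (y : K.X (p + 1) ⟶ N) :
    (toDisk y).f p = (K.d p (p + 1) ≫ y) ≫ (doubleXIso₀ (𝟙 N) (up_rel _)).inv := by
  simp [toDisk]

@[simp]
theorem toDisk_f₁ (y : K.X (p + 1) ⟶ N) :
    (toDisk y).f (p + 1) = y ≫ (doubleXIso₁ (𝟙 N) (up_rel _) (by omega)).inv := by
  simp [toDisk]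

theorem fromDisk_comp {L : CochainComplex C ℤ} (x : N ⟶ K.X p) (v : K ⟶ L) (h : x ≫ v.f p = 0) :
    fromDisk x ≫ v = 0 := by
  apply from_double_hom_ext
  · simp [h]
  · simp [-Hom.comm, ← v.comm, reassoc_of% h]

theorem comp_toDisk {L : CochainComplex C ℤ} (u : L ⟶ K) (y : K.X (p + 1) ⟶ N)
    (h : u.f (p + 1) ≫ y = 0) : u ≫ toDisk y = 0 := by
  apply to_double_hom_ext
  · simp [reassoc_of% h]
  · simp [reassoc_of% h]

theorem fromDisk_toDisk (x : N ⟶ K.X p) (y : K.X (p + 1) ⟶ N)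
    (h : x ≫ K.d p (p + 1) ≫ y = 𝟙 N) : fromDisk x ≫ toDisk y = 𝟙 (disk N p) := by
  apply from_double_hom_ext
  · simp [reassoc_of% h]
  · simp [reassoc_of% h]

end disk

variable [HasBinaryBiproducts C]

theorem Equivalent.trans {K L M : {K : CochainComplex C ℤ // Bounded K}} (h : Equivalent K L)
    (h' : Equivalent L M) : Equivalent K M := Relation.EqvGen.trans _ _ _ h h'

theorem Equivalent.of_iso {K L : {K : CochainComplex C ℤ // Bounded K}} (e : K.1 ≅ L.1) :
    Equivalent K L := Relation.EqvGen.rel _ _ (.inl ⟨e⟩)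

variable [HasZeroObject C]

theorem equivalent_biprod_disk (R : CochainComplex C ℤ) (N : C) (p : ℤ) (hR : Bounded R)
    (hR' : Bounded (R ⊞ disk N p)) : Equivalent ⟨R ⊞ disk N p, hR'⟩ ⟨R, hR⟩ := by
  have hid (i) : (biprod.fst : R ⊞ disk N p ⟶ R).f i ≫ (biprod.inl : R ⟶ R ⊞ disk N p).f i +
      (biprod.snd : R ⊞ disk N p ⟶ _).f i ≫ (biprod.inr : _ ⟶ R ⊞ disk N p).f i = 𝟙 _ := by
    rw [← HomologicalComplex.comp_f, ← HomologicalComplex.comp_f,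
      ← HomologicalComplex.add_f_apply, biprod.total, HomologicalComplex.id_f]
  have hs (i) : (biprod.inr : _ ⟶ R ⊞ disk N p).f i ≫ (biprod.snd : R ⊞ disk N p ⟶ _).f i =
      𝟙 _ := by
    rw [← HomologicalComplex.comp_f, biprod.inr_snd, HomologicalComplex.id_f]
  have hd := HomologicalComplex.double_d (𝟙 N) (up_rel p) (by omega)
  refine Relation.EqvGen.rel _ _ (.inr (.inl ⟨CancelSub.ofRetract biprod.inl biprod.fst
    biprod.inl_fst p N ((HomologicalComplex.doubleXIso₀ (𝟙 N) (up_rel _)).inv ≫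
      (biprod.inr : _ ⟶ R ⊞ disk N p).f p)
    ((biprod.snd : R ⊞ disk N p ⟶ _).f (p + 1) ≫
      (HomologicalComplex.doubleXIso₁ (𝟙 N) (up_rel _) (by omega)).hom) ?_ ?_ ?_ ?_ ?_ ?_⟩))
  · simp [reassoc_of% hs, hd]
  · simp [← HomologicalComplex.comp_f]
  · simp [← HomologicalComplex.comp_f_assoc]
  · intro i hi hi'
    rw [← hid i, (HomologicalComplex.isZero_double_X (𝟙 N) _ i hi hi').eq_zero_of_tgt
      ((biprod.snd : R ⊞ disk N p ⟶ _).f i), zero_comp, add_zero]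
  · rw [← hid p]
    simp [← HomologicalComplex.Hom.comm_assoc, hd]
  · rw [← hid (p + 1)]
    simp [hd]

/-- If `R` is a retract of `K` and the complement is a finite direct sum of complexes `N → N` with
differential `1`, then `K` and `R` are equivalent. -/
theorem equivalent_of_retract_of_sum (N : ℤ → C) {K : CochainComplex C ℤ} (hK : Bounded K)
    (x : ∀ i, disk (N i) i ⟶ K) (y : ∀ i, K ⟶ disk (N i) i) (s : Finset ℤ)
    (hxy : ∀ i ∈ s, x i ≫ y i = 𝟙 _) (hxy' : ∀ i j, i ≠ j → x i ≫ y j = 0) :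
    ∀ {R : CochainComplex C ℤ} (hR : Bounded R) (u : R ⟶ K) (v : K ⟶ R), u ≫ v = 𝟙 R →
      (∀ i ∈ s, x i ≫ v = 0) → (∀ i ∈ s, u ≫ y i = 0) → v ≫ u + ∑ i ∈ s, y i ≫ x i = 𝟙 K →
      Equivalent ⟨K, hK⟩ ⟨R, hR⟩ := by
  induction s using Finset.induction_on with
  | empty =>
    intro R hR u v huv _ _ hid
    exact Equivalent.of_iso ⟨v, u, by simpa using hid, huv⟩
  | insert a s ha ih =>
    intro R hR u v huv hx hy hid
    -- absorb the summand with index `a` into the retract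
    have huv' : biprod.desc u (x a) ≫ biprod.lift v (y a) = 𝟙 (R ⊞ disk (N a) a) := by
      apply biprod.hom_ext' <;> apply biprod.hom_ext <;>
        simp [huv, hx a (by simp), hy a (by simp), hxy a (by simp)]
    refine (ih (fun i hi => hxy i (by simp [hi])) (hK.of_retract _ _ huv') _ _ huv' ?_ ?_ ?_).trans
      (equivalent_biprod_disk R (N a) a hR _)
    · intro i hi
      apply biprod.hom_ext
      · simp [hx i (by simp [hi])]
      · simp [hxy' i a (by rintro rfl; exact ha hi)]
    · intro i hi
      apply biprod.hom_ext'
      · simp [hy i (by simp [hi])]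
      · simp [hxy' a i (by rintro rfl; exact ha hi)]
    · rw [← hid, Finset.sum_insert ha, biprod.lift_desc, add_assoc]

end splitting

section splitting

variable {C : Type*} [Category C] [Preadditive C] [HasBinaryBiproducts C] [HasZeroObject C]

/-- If `R` is a retract of `K` and the complement is, in degree `i`, the direct sum of `N i` and
`N (i - 1)`, with the differential of `K` inducing the identity of `N i`, then `K` and `R` are
equivalent. -/
theorem equivalent_of_retract {K R : CochainComplex C ℤ} (hK : Bounded K) (hR : Bounded R)
    (u : R ⟶ K) (v : K ⟶ R) (huv : u ≫ v = 𝟙 R) (N : ℤ → C) (s : Finset ℤ)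
    (hN : ∀ i ∉ s, IsZero (N i)) (x : ∀ i, N i ⟶ K.X i) (y : ∀ i, K.X (i + 1) ⟶ N i)
    (hxy : ∀ i, x i ≫ K.d i (i + 1) ≫ y i = 𝟙 _) (hx : ∀ i, x i ≫ v.f i = 0)
    (hy : ∀ i, u.f (i + 1) ≫ y i = 0) (hyx : ∀ i, x (i + 1) ≫ y i = 0)
    (hid : ∀ i, v.f (i + 1) ≫ u.f (i + 1) + K.d (i + 1) (i + 1 + 1) ≫ y (i + 1) ≫ x (i + 1) +
      y i ≫ x i ≫ K.d i (i + 1) = 𝟙 _) :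
    Equivalent ⟨K, hK⟩ ⟨R, hR⟩ := by
  refine equivalent_of_retract_of_sum N hK (fun i => fromDisk (x i)) (fun i => toDisk (y i)) s
    (fun i _ => fromDisk_toDisk _ _ (hxy i)) (fun i j hij => ?_) hR u v huv
    (fun i _ => fromDisk_comp _ _ (hx i)) (fun i _ => comp_toDisk _ _ (hy i)) ?_
  · apply fromDisk_comp
    by_cases h : i = j + 1
    · subst h
      simp [reassoc_of% hyx]
    · exact (HomologicalComplex.isZero_double_X _ _ _ hij h).eq_of_tgt _ _
  · ext k
    obtain ⟨i, rfl⟩ : ∃ i, k = i + 1 := ⟨k - 1, by omega⟩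
    let t (j : ℤ) : K ⟶ K := toDisk (y j) ≫ fromDisk (x j)
    -- only `N (i + 1)` and `N i` contribute in degree `i + 1`
    have h : ∑ j ∈ s, (t j).f (i + 1) = (t (i + 1)).f (i + 1) + (t i).f (i + 1) := by
      rw [← Finset.sum_pair (f := fun j => (t j).f (i + 1)) (show i + 1 ≠ i by omega),
        Finset.sum_subset (Finset.subset_union_left (s₂ := {i + 1, i})),
        ← Finset.sum_subset (Finset.subset_union_right (s₁ := s))]
      · intro j _ hj
        simp only [Finset.mem_insert, Finset.mem_singleton, not_or] at hj
        have := HomologicalComplex.isZero_double_X (𝟙 (N j)) (up_rel j) (i + 1) (Ne.symm hj.1)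
          (by omega)
        rw [HomologicalComplex.comp_f, this.eq_zero_of_tgt ((toDisk (y j)).f (i + 1)), zero_comp]
      · intro j _ hj
        have h₀ : y j = 0 := (hN j hj).eq_zero_of_tgt _
        have : toDisk (y j) = 0 := HomologicalComplex.to_double_hom_ext (by simp [h₀])
          (by simp [h₀])
        simp [t, this]
    have h' : (∑ j ∈ s, t j).f (i + 1) = ∑ j ∈ s, (t j).f (i + 1) :=
      (HomologicalComplex.eval C _ (i + 1)).map_sum t s
    rw [HomologicalComplex.add_f_apply, h', h, HomologicalComplex.id_f, ← hid i]
    simp [t, add_assoc]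

end splitting

/-! ### Truncated one-entry matrices -/

section truncation

variable {C : Type*} [Category C] [Preadditive C]

/-- The object `X` if `c` holds, and the zero object otherwise. -/
noncomputable def trunc (c : Prop) (X : C) : Mat_ C where
  ι := PLift c
  fintype := Fintype.ofFinite _
  X _ := X

/-- The map `f` if both objects are present, and zero otherwise. -/
def truncMap {c c' : Prop} {X Y : C} (f : X ⟶ Y) : trunc c X ⟶ trunc c' Y := fun _ _ => f

variable {c c' c'' : Prop} {X Y Z : C}

theorem truncMap_congr {f g : X ⟶ Y} (h : c → c' → f = g) :
    (truncMap f : trunc c X ⟶ trunc c' Y) = truncMap g :=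
  Mat_.hom_ext _ _ fun i j => h i.down j.down

open scoped Classical in
theorem truncMap_comp (f : X ⟶ Y) (g : Y ⟶ Z) :
    (truncMap f : trunc c X ⟶ trunc c' Y) ≫ (truncMap g : _ ⟶ trunc c'' Z) =
      truncMap (if c' then f ≫ g else 0) := by
  apply Mat_.hom_ext
  intro x y
  by_cases h : c'
  · have : Subsingleton (trunc c' Y).ι := inferInstanceAs (Subsingleton (PLift _))
    exact (Fintype.sum_subsingleton (fun z : (trunc c' Y).ι => f ≫ g) ⟨h⟩).trans (if_pos h).symm
  · exact (Finset.sum_eq_zero fun z _ => absurd z.down h).trans (if_neg h).symm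

theorem truncMap_add (f g : X ⟶ Y) :
    (truncMap f : trunc c X ⟶ trunc c' Y) + truncMap g = truncMap (f + g) := rfl

theorem truncMap_zero : (truncMap 0 : trunc c X ⟶ trunc c' Y) = 0 := rfl

theorem truncMap_id : (𝟙 (trunc c X)) = truncMap (𝟙 X) := by
  apply Mat_.hom_ext
  rintro ⟨x⟩ ⟨y⟩
  exact Mat_.id_apply_self _ _

theorem isZero_trunc (h : ¬c) : IsZero (trunc c X) :=
  (IsZero.iff_id_eq_zero _).2 (Mat_.hom_ext _ _ fun x => absurd x.down h)

end truncation

/-! ### Eliminations -/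

section elimination

variable {C : Type*} [Category C] [Preadditive C] {G H : ℕ → C}

/-- Decompositions `H 0 ≅ G 1` and `H (j + 1) ≅ G (j + 1) ⊞ G (j + 2)` of the terms of the bottom
row of a bicomplex: `q` and `β` are the projection and inclusion of the first summand `G j` of
`H j` (absent for `j = 0`), `π` and `κ` those of the second summand `G (j + 1)`. In these
coordinates `v j` is `(1, D j)`, and `D' j` maps the second summand of `H j` identically to the
first summand of `H (j + 1)` and vanishes on the first. -/
structure Elimination (D : ∀ j, G j ⟶ G (j + 1)) (D' : ∀ j, H j ⟶ H (j + 1))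
    (v : ∀ j, G j ⟶ H j) where
  q : ∀ j, H j ⟶ G j
  β : ∀ j, G j ⟶ H j
  π : ∀ j, H j ⟶ G (j + 1)
  κ : ∀ j, G (j + 1) ⟶ H j
  q_zero : q 0 = 0
  κ_π : ∀ j, κ j ≫ π j = 𝟙 _
  κ_q : ∀ j, κ j ≫ q j = 0
  total : ∀ j, q j ≫ β j + π j ≫ κ j = 𝟙 _
  v_q : ∀ j, v (j + 1) ≫ q (j + 1) = 𝟙 _
  v_π : ∀ j, v j ≫ π j = D j
  D'_q : ∀ j, D' j ≫ q (j + 1) = π j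
  D'_π : ∀ j, D' j ≫ π (j + 1) = 0

namespace Elimination

variable {D : ∀ j, G j ⟶ G (j + 1)} {D' : ∀ j, H j ⟶ H (j + 1)} {v : ∀ j, G j ⟶ H j}
  (F : Elimination D D' v)

include F in
theorem D'_eq (j : ℕ) : D' j = F.π j ≫ F.β (j + 1) := by
  rw [← Category.comp_id (D' j), ← F.total (j + 1), Preadditive.comp_add, ← Category.assoc,
    ← Category.assoc, F.D'_q, F.D'_π, zero_comp, add_zero]

theorem κ_D' (j : ℕ) : F.κ j ≫ D' j = F.β (j + 1) := by
  rw [F.D'_eq, ← Category.assoc, F.κ_π, Category.id_comp]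

theorem v_zero : v 0 = D 0 ≫ F.κ 0 := by
  rw [← Category.comp_id (v 0), ← F.total 0, F.q_zero, zero_comp, zero_add, ← Category.assoc, F.v_π]

theorem v_succ (j : ℕ) : v (j + 1) = F.β (j + 1) + D (j + 1) ≫ F.κ (j + 1) := by
  rw [← Category.comp_id (v (j + 1)), ← F.total (j + 1), Preadditive.comp_add, ← Category.assoc,
    ← Category.assoc, F.v_π, F.v_q, Category.id_comp]

/-- The projection of `H j` onto its second summand along the image of `v j`. -/
def w (j : ℕ) : H j ⟶ G (j + 1) := F.π j - F.q j ≫ D j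

theorem v_w_succ (j : ℕ) : v (j + 1) ≫ F.w (j + 1) = 0 := by
  simp [w, F.v_π, reassoc_of% F.v_q]

theorem v_w_zero : v 0 ≫ F.w 0 = D 0 := by simp [w, F.v_π, F.q_zero]

theorem κ_w (j : ℕ) : F.κ j ≫ F.w j = 𝟙 _ := by
  simp [w, F.κ_π, reassoc_of% F.κ_q]

theorem D'_w (j : ℕ) : D' j ≫ F.w (j + 1) = -(F.π j ≫ D (j + 1)) := by
  simp [w, F.D'_π, reassoc_of% F.D'_q]

theorem w_D (hD : ∀ j, D j ≫ D (j + 1) = 0) (j : ℕ) :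
    F.w j ≫ D (j + 1) = F.π j ≫ D (j + 1) := by
  simp [w, hD]

/-- The image of `v j` and the second summand span `H j`. -/
theorem w_κ_add (j : ℕ) : F.w j ≫ F.κ j + F.q j ≫ v j = 𝟙 _ := by
  rw [← F.total j]
  cases j with
  | zero => simp [w, F.q_zero]
  | succ j => rw [F.v_succ]; simp [w]; abel

end Elimination

/-! ### A total complex without signs and with reindexed bottom row -/

/-- The sequence `H` moved one step to the right; the value at `0` is irrelevant. -/
def shiftObj (H : ℕ → C) : ℕ → C
  | 0 => H 0
  | j + 1 => H j

/-- The maps `D` moved one step to the right. -/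
def shiftD {H : ℕ → C} (D : ∀ j, H j ⟶ H (j + 1)) : ∀ j, shiftObj H j ⟶ shiftObj H (j + 1)
  | 0 => 0
  | j + 1 => D j

/-- The maps `f : H j ⟶ G (j + 1)` as maps from the sequence `H` moved to the right. -/
def fromShift (f : ∀ j, H j ⟶ G (j + 1)) : ∀ j, shiftObj H j ⟶ G j
  | 0 => 0
  | j + 1 => f j

/-- The maps `f : G (j + 1) ⟶ H j` as maps to the sequence `H` moved to the right. -/
def toShift (f : ∀ j, G (j + 1) ⟶ H j) : ∀ j, G j ⟶ shiftObj H j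
  | 0 => 0
  | j + 1 => f j

/-- The maps `v`, extended by zero, as maps of degree one to `H` moved to the right. -/
def extUp (v : ∀ j, G j ⟶ H j) : ∀ i : ℤ, extObj G i ⟶ extObj (shiftObj H) (i + 1)
  | .ofNat j => v j
  | .negSucc _ => 0

/-- The maps `q`, extended by zero, as maps of degree minus one from `H` moved to the right. -/
def extDown (q : ∀ j, H j ⟶ G j) : ∀ i : ℤ, extObj (shiftObj H) (i + 1) ⟶ extObj G i
  | .ofNat j => q j
  | .negSucc _ => 0

section identities

variable {D : ∀ j, G j ⟶ G (j + 1)} {D' : ∀ j, H j ⟶ H (j + 1)} {v : ∀ j, G j ⟶ H j}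

theorem shiftD_comp (hD' : ∀ j, D' j ≫ D' (j + 1) = 0) :
    ∀ j, shiftD D' j ≫ shiftD D' (j + 1) = 0
  | 0 => zero_comp
  | j + 1 => hD' j

theorem extD_extUp (hv : ∀ j, v j ≫ D' j = D j ≫ v (j + 1)) :
    ∀ i, extD D i ≫ extUp v (i + 1) = extUp v i ≫ extD (shiftD D') (i + 1)
  | .ofNat j => (hv j).symm
  | .negSucc _ => zero_comp.trans zero_comp.symm

namespace Elimination

variable (F : Elimination D D' v)

/-- The maps `v` factor through the second summands up to a homotopy; this makes `inclX` a morphism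
of complexes. -/
theorem extUp_eq : ∀ i, extUp v i = extD D i ≫ extV (toShift F.κ) (i + 1) +
    extV (toShift F.κ) i ≫ extD (shiftD D') i
  | 0 => F.v_zero.trans ((add_zero _).symm.trans (congrArg _ zero_comp.symm))
  | .ofNat (j + 1) => (F.v_succ j).trans ((add_comm _ _).trans (congrArg _ (F.κ_D' j).symm))
  | .negSucc _ => (add_zero _).symm.trans (congrArg₂ _ zero_comp.symm zero_comp.symm)

theorem extUp_w : ∀ i, extUp v i ≫ extV (fromShift F.w) (i + 1) = if i = 0 then extD D i else 0
  | 0 => F.v_w_zero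
  | .ofNat (j + 1) => F.v_w_succ j
  | .negSucc _ => zero_comp

theorem extD_w (hD : ∀ j, D j ≫ D (j + 1) = 0) :
    ∀ i, extD (shiftD D') i ≫ extV (fromShift F.w) (i + 1) = -(extV (fromShift F.w) i ≫ extD D i)
  | 0 => zero_comp.trans (neg_zero.symm.trans (congrArg _ zero_comp.symm))
  | .ofNat (j + 1) => (F.D'_w j).trans (congrArg _ (F.w_D hD j).symm)
  | .negSucc _ => zero_comp.trans (neg_zero.symm.trans (congrArg _ zero_comp.symm))

theorem ext_κ_w : ∀ i, 0 < i → extV (toShift F.κ) i ≫ extV (fromShift F.w) i = 𝟙 _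
  | 0, h => absurd h (by omega)
  | .ofNat (j + 1), _ => F.κ_w j
  | .negSucc _, h => absurd h (by omega)

theorem ext_v_q : ∀ i, 0 < i → extUp v i ≫ extDown F.q i = 𝟙 _
  | 0, h => absurd h (by omega)
  | .ofNat (j + 1), _ => F.v_q j
  | .negSucc _, h => absurd h (by omega)

theorem ext_κ_q : ∀ i, extV (toShift F.κ) (i + 1) ≫ extDown F.q i = 0
  | .ofNat j => F.κ_q j
  | .negSucc _ => comp_zero

theorem ext_κ_zero : ∀ i, i = 0 → extV (toShift F.κ) i = 0
  | _, rfl => rfl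

theorem ext_w_add : ∀ i, 0 ≤ i → extV (fromShift F.w) (i + 1) +
    (extDown F.q i ≫ extD D i - extD (shiftD D') (i + 1) ≫ extDown F.q (i + 1)) = 0
  | .ofNat j, _ => by
    have h : F.w j + (F.q j ≫ D j - D' j ≫ F.q (j + 1)) = 0 := by simp [w, F.D'_q]
    exact h
  | .negSucc _, h => absurd h (by omega)

theorem ext_w_κ_add : ∀ i, 0 ≤ i → extV (fromShift F.w) (i + 1) ≫ extV (toShift F.κ) (i + 1) +
    extDown F.q i ≫ extUp v i = 𝟙 _
  | .ofNat j, _ => F.w_κ_add j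
  | .negSucc _, h => absurd h (by omega)

theorem ext_q_zero : ∀ i, i = 0 → extDown F.q i = 0
  | _, rfl => F.q_zero

end Elimination

end identities

variable (G) in
/-- The top row in degree `i` of the total complex. -/
noncomputable abbrev topX (m : ℕ) (i : ℤ) : Mat_ C := trunc (0 ≤ i ∧ i ≤ m) (extObj G i)

variable (H) in
/-- The bottom row in degree `i` of the total complex. -/
noncomputable abbrev botX (m : ℕ) (i : ℤ) : Mat_ C :=
  trunc (1 ≤ i ∧ i ≤ m + 1) (extObj (shiftObj H) i)

variable [HasBinaryBiproducts (Mat_ C)] {D : ∀ j, G j ⟶ G (j + 1)} {D' : ∀ j, H j ⟶ H (j + 1)}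
  {v : ∀ j, G j ⟶ H j}

variable (D D' v) in
/-- The differential `(D, v; 0, -D')`. -/
noncomputable def coneD (m : ℕ) (i : ℤ) :
    topX G m i ⊞ botX H m i ⟶ topX G m (i + 1) ⊞ botX H m (i + 1) :=
  Biprod.ofComponents (truncMap (extD D i)) (truncMap (extUp v i)) 0
    (truncMap (-extD (shiftD D') i))

theorem coneD_comp (hD : ∀ j, D j ≫ D (j + 1) = 0) (hD' : ∀ j, D' j ≫ D' (j + 1) = 0)
    (hv : ∀ j, v j ≫ D' j = D j ≫ v (j + 1)) (m : ℕ) (i : ℤ) :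
    coneD D D' v m i ≫ coneD D D' v m (i + 1) = 0 := by
  simp only [coneD]
  rw [Biprod.ofComponents_comp]
  apply biprod.hom_ext' <;> apply biprod.hom_ext <;>
    simp [truncMap_comp, truncMap_add, ← truncMap_zero]
  · exact truncMap_congr fun h h' => by simp [extD_comp hD]
  · refine truncMap_congr fun h h' => ?_
    rw [if_pos (by omega), if_pos (by omega), extD_extUp hv]
    simp
  · exact truncMap_congr fun h h' => by simp [extD_comp (shiftD_comp hD')]

theorem inl_coneD (m : ℕ) (i : ℤ) : biprod.inl ≫ coneD D D' v m i =
    biprod.lift (truncMap (extD D i)) (truncMap (extUp v i)) := by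
  apply biprod.hom_ext <;> simp [coneD]

theorem inr_coneD (m : ℕ) (i : ℤ) : biprod.inr ≫ coneD D D' v m i =
    truncMap (-extD (shiftD D') i) ≫ biprod.inr := by
  apply biprod.hom_ext <;> simp [coneD]

/-- The complex with terms `G i ⊞ H (i - 1)` and differential `(D, v; 0, -D')`. -/
noncomputable def coneCx (hD : ∀ j, D j ≫ D (j + 1) = 0) (hD' : ∀ j, D' j ≫ D' (j + 1) = 0)
    (hv : ∀ j, v j ≫ D' j = D j ≫ v (j + 1)) (m : ℕ) : CochainComplex (Mat_ C) ℤ :=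
  CochainComplex.of (fun i => topX G m i ⊞ botX H m i) (coneD D D' v m) (coneD_comp hD hD' hv m)

namespace Elimination

variable (F : Elimination D D' v) (hD : ∀ j, D j ≫ D (j + 1) = 0)
  (hD' : ∀ j, D' j ≫ D' (j + 1) = 0) (hv : ∀ j, v j ≫ D' j = D j ≫ v (j + 1)) (m : ℕ)

/-- The inclusion of the row with one more term: the identity to the top row, `κ` to the bottom
row. -/
noncomputable def inclX (i : ℤ) : topX G (m + 1) i ⟶ topX G m i ⊞ botX H m i :=
  biprod.lift (truncMap (𝟙 _)) (truncMap (extV (toShift F.κ) i))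

/-- The projection to the row with one more term: the identity in degree `0` of the top row, and `w`
on the bottom row. -/
noncomputable def projX (i : ℤ) : topX G m i ⊞ botX H m i ⟶ topX G (m + 1) i :=
  biprod.desc (truncMap (if i = 0 then 𝟙 _ else 0)) (truncMap (extV (fromShift F.w) i))

theorem inclX_comm (i : ℤ) :
    F.inclX m i ≫ coneD D D' v m i = truncMap (extD D i) ≫ F.inclX m (i + 1) := by
  apply biprod.hom_ext <;> simp [inclX, coneD, truncMap_comp, truncMap_add, F.extUp_eq]
  · refine truncMap_congr fun h h' => ?_
    split_ifs <;> first | omega | rfl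
  · refine truncMap_congr fun h h' => ?_
    split_ifs <;> try omega
    · abel
    · obtain rfl : i = 0 := by omega
      simp [F.ext_κ_zero]

include hD in
theorem projX_comm (i : ℤ) :
    F.projX m i ≫ truncMap (extD D i) = coneD D D' v m i ≫ F.projX m (i + 1) := by
  apply biprod.hom_ext' <;> simp [projX, reassoc_of% inl_coneD, reassoc_of% inr_coneD,
    truncMap_comp, truncMap_add, F.extUp_w, F.extD_w hD]
  · refine truncMap_congr fun h h' => ?_
    split_ifs <;> first | omega | simp
  · refine truncMap_congr fun h h' => ?_
    split_ifs <;> first | omega | rfl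

theorem inclX_projX (i : ℤ) : F.inclX m i ≫ F.projX m i = 𝟙 _ := by
  simp [projX, inclX, truncMap_comp, truncMap_add, truncMap_id]
  refine truncMap_congr fun h h' => ?_
  split_ifs <;> first | omega | simp; done | simpa using F.ext_κ_w i (by omega)

/-- The inclusion of the cancelled summands. -/
noncomputable def cancelIn (G H : ℕ → C) (m : ℕ) (i : ℤ) :
    trunc (1 ≤ i ∧ i ≤ m) (extObj G i) ⟶ topX G m i ⊞ botX H m i :=
  truncMap (𝟙 _) ≫ biprod.inl

/-- The projection to the cancelled summands. -/
noncomputable def cancelOut (i : ℤ) :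
    topX G m (i + 1) ⊞ botX H m (i + 1) ⟶ trunc (1 ≤ i ∧ i ≤ m) (extObj G i) :=
  biprod.snd ≫ truncMap (extDown F.q i)

theorem cancelIn_coneD_cancelOut (i : ℤ) :
    cancelIn G H m i ≫ coneD D D' v m i ≫ F.cancelOut m i = 𝟙 _ := by
  simp [cancelIn, cancelOut, reassoc_of% inl_coneD, truncMap_comp, truncMap_id]
  refine truncMap_congr fun h h' => ?_
  split_ifs <;> first | omega | exact F.ext_v_q i (by omega)

theorem cancelIn_projX (i : ℤ) : cancelIn G H m i ≫ F.projX m i = 0 := by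
  simp [cancelIn, projX, truncMap_comp, ← truncMap_zero]
  refine truncMap_congr fun h h' => ?_
  split_ifs <;> first | omega | rfl

theorem inclX_cancelOut (i : ℤ) : F.inclX m (i + 1) ≫ F.cancelOut m i = 0 := by
  simp [inclX, cancelOut, truncMap_comp, ← truncMap_zero, F.ext_κ_q]

theorem cancelIn_cancelOut (i : ℤ) : cancelIn G H m (i + 1) ≫ F.cancelOut m i = 0 := by
  simp [cancelIn, cancelOut]

/-- The complement of the longer row is, in degree `i + 1`, the sum of the cancelled terms of
degrees `i + 1` and `i`, the latter embedded through the differential. -/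
theorem total_eq (i : ℤ) : F.projX m (i + 1) ≫ F.inclX m (i + 1) +
    coneD D D' v m (i + 1) ≫ F.cancelOut m (i + 1) ≫ cancelIn G H m (i + 1) +
    F.cancelOut m i ≫ cancelIn G H m i ≫ coneD D D' v m i = 𝟙 _ := by
  apply biprod.hom_ext' <;> apply biprod.hom_ext <;>
    simp [projX, inclX, cancelIn, cancelOut, reassoc_of% inl_coneD, inl_coneD,
      reassoc_of% inr_coneD, truncMap_comp, truncMap_add, truncMap_id, ← truncMap_zero]
  · refine truncMap_congr fun h h' => ?_
    split_ifs <;> first | omega | simp; done | simpa using F.ext_v_q (i + 1) (by omega)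
  · refine truncMap_congr fun h h' => ?_
    split_ifs <;> first | omega | simp
  · refine truncMap_congr fun h h' => ?_
    have := F.ext_w_add i (by omega)
    split_ifs <;> try omega
    · rw [← this]
      simp
      abel
    · rw [F.ext_q_zero i (by omega), zero_comp, zero_sub] at this
      simpa using this
  · refine truncMap_congr fun h h' => ?_
    have := F.ext_w_κ_add i (by omega)
    split_ifs <;> try omega
    · rw [F.ext_q_zero i (by omega)] at this
      simpa using this

/-- The inclusion of the row with one more term, as a morphism of complexes. -/
noncomputable def incl : row D hD (m + 1) ⟶ coneCx hD hD' hv m :=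
  CochainComplex.ofHom (X := row D hD (m + 1)) (Y := coneCx hD hD' hv m) (F.inclX m) (fun i => by
    dsimp only [row, coneCx, CochainComplex.of]
    rw [CochainComplex.of_d, CochainComplex.of_d]
    exact F.inclX_comm m i)

/-- The projection to the row with one more term, as a morphism of complexes. -/
noncomputable def proj : coneCx hD hD' hv m ⟶ row D hD (m + 1) :=
  CochainComplex.ofHom (X := coneCx hD hD' hv m) (Y := row D hD (m + 1)) (F.projX m) (fun i => by
    dsimp only [row, coneCx, CochainComplex.of]
    rw [CochainComplex.of_d, CochainComplex.of_d]
    exact F.projX_comm hD m i)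

theorem coneCx_d (i : ℤ) : (coneCx hD hD' hv m).d i (i + 1) = coneD D D' v m i :=
  CochainComplex.of_d (fun i => topX G m i ⊞ botX H m i) (coneD D D' v m) i

include F in
theorem equivalent_coneCx [HasZeroObject (Mat_ C)] (hK : Bounded (coneCx hD hD' hv m)) :
    Equivalent ⟨coneCx hD hD' hv m, hK⟩ ⟨row D hD (m + 1), row_bounded D hD (m + 1)⟩ := by
  refine equivalent_of_retract hK _ (F.incl hD hD' hv m) (F.proj hD hD' hv m) ?_
    (fun i => trunc (1 ≤ i ∧ i ≤ m) (extObj G i)) (Finset.Icc 1 (m : ℤ)) ?_ (cancelIn G H m)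
    (F.cancelOut m) ?_ ?_ ?_ ?_ ?_
  · ext1 i
    exact F.inclX_projX m i
  · intro i hi
    exact isZero_trunc fun h => hi (Finset.mem_Icc.2 h)
  · intro i
    rw [coneCx_d]
    exact F.cancelIn_coneD_cancelOut m i
  · exact F.cancelIn_projX m
  · exact F.inclX_cancelOut m
  · exact F.cancelIn_cancelOut m
  · intro i
    rw [coneCx_d, coneCx_d]
    exact F.total_eq m i

end Elimination

end elimination

/-! ### Comparison with the total complex -/

section reindex

variable {C : Type*} [Category C] [Preadditive C] {G H : ℕ → C}

/-- The identification of degree `a` of `H` with degree `i = a + 1` of `H` moved to the right. -/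
def extShift (H : ℕ → C) : ∀ a i : ℤ, i = a + 1 → (extObj H a ⟶ extObj (shiftObj H) i)
  | .ofNat j, _, rfl => 𝟙 (H j)
  | .negSucc _, _, _ => 0

/-- The inverse of `extShift`. -/
def extUnshift (H : ℕ → C) : ∀ a i : ℤ, i = a + 1 → (extObj (shiftObj H) i ⟶ extObj H a)
  | .ofNat j, _, rfl => 𝟙 (H j)
  | .negSucc _, _, _ => 0

theorem extShift_unshift : ∀ (a i : ℤ) (h : i = a + 1), 0 ≤ a →
    extShift H a i h ≫ extUnshift H a i h = 𝟙 _
  | .ofNat _, _, rfl, _ => Category.comp_id _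
  | .negSucc _, _, _, h => absurd h (by omega)

theorem extUnshift_shift : ∀ (a i : ℤ) (h : i = a + 1), 0 ≤ a →
    extUnshift H a i h ≫ extShift H a i h = 𝟙 _
  | .ofNat _, _, rfl, _ => Category.comp_id _
  | .negSucc _, _, _, h => absurd h (by omega)

variable {D : ∀ j, G j ⟶ G (j + 1)} {D' : ∀ j, H j ⟶ H (j + 1)} {v : ∀ j, G j ⟶ H j}

theorem extD_extShift : ∀ a : ℤ, extD D' a ≫ extShift H (a + 1) (a + 1 + 1) rfl =
    extShift H a (a + 1) rfl ≫ extD (shiftD D') (a + 1)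
  | .ofNat _ => (Category.comp_id _).trans (Category.id_comp _).symm
  | .negSucc _ => zero_comp.trans zero_comp.symm

theorem extV_extShift : ∀ a : ℤ, extV v a ≫ extShift H a (a + 1) rfl = extUp v a
  | .ofNat _ => Category.comp_id _
  | .negSucc _ => zero_comp

/-- The identification of degree `a` of the row `H` with degree `i = a + 1` of the bottom row of
`coneCx`. -/
noncomputable def botIso (H : ℕ → C) (m : ℕ) (a i : ℤ) (h : i = a + 1) :
    topX H m a ≅ botX H m i where
  hom := truncMap (extShift H a i h)
  inv := truncMap (extUnshift H a i h)
  hom_inv_id := by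
    rw [truncMap_comp, truncMap_id]
    refine truncMap_congr fun h₁ h₂ => ?_
    rw [if_pos (by omega), extShift_unshift _ _ _ h₁.1]
  inv_hom_id := by
    rw [truncMap_comp, truncMap_id]
    refine truncMap_congr fun h₁ h₂ => ?_
    rw [if_pos (by omega), extUnshift_shift _ _ _ (by omega)]

theorem extD_botIso (m : ℕ) (a : ℤ) :
    (truncMap (extD D' a) : topX H m a ⟶ topX H m (a + 1)) ≫ (botIso H m (a + 1) _ rfl).hom =
      (botIso H m a _ rfl).hom ≫ truncMap (extD (shiftD D') (a + 1)) := by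
  simp only [botIso]
  rw [truncMap_comp, truncMap_comp, extD_extShift]
  refine truncMap_congr fun h₁ h₂ => ?_
  rw [if_pos (by omega), if_pos (by omega)]

theorem extV_botIso (m : ℕ) (a : ℤ) :
    (truncMap (extV v a) : topX G m a ⟶ topX H m a) ≫ (botIso H m a _ rfl).hom =
      truncMap (extUp v a) := by
  simp only [botIso]
  rw [truncMap_comp, extV_extShift]
  exact truncMap_congr fun h₁ h₂ => by rw [if_pos (by omega)]

/-- `botIso` for the terms of the complex `row D' hD' m`. -/
noncomputable def rowBotIso (hD' : ∀ j, D' j ≫ D' (j + 1) = 0) (m : ℕ) (a i : ℤ) (h : i = a + 1) :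
    (row D' hD' m).X a ≅ botX H m i := botIso H m a i h

theorem row_d_rowBotIso (hD' : ∀ j, D' j ≫ D' (j + 1) = 0) (m : ℕ) (a a' i : ℤ) (h : i = a + 1)
    (h' : i + 1 = a' + 1) :
    (row D' hD' m).d a a' ≫ (rowBotIso hD' m a' (i + 1) h').hom =
      (rowBotIso hD' m a i h).hom ≫ truncMap (extD (shiftD D') i) := by
  obtain rfl : a' = a + 1 := by omega
  subst h
  have hd : (row D' hD' m).d a (a + 1) = rowD D' m a := CochainComplex.of_d ..
  rw [hd]
  exact extD_botIso m a

variable (hD : ∀ j, D j ≫ D (j + 1) = 0) (hD' : ∀ j, D' j ≫ D' (j + 1) = 0)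
  (hv : ∀ j, v j ≫ D' j = D j ≫ v (j + 1)) (m : ℕ)

theorem rowMap_rowBotIso (a' i : ℤ) (h : a' = i) (h' : i + 1 = a' + 1) :
    (rowMap (hD := hD) (hD' := hD') v hv m).f i ≫
      ((row D' hD' m).XIsoOfEq h).inv ≫ (rowBotIso hD' m a' (i + 1) h').hom =
      (truncMap (extUp v i) : topX G m i ⟶ botX H m (i + 1)) := by
  subst h
  rw [HomologicalComplex.XIsoOfEq_rfl, Iso.refl_inv, Category.id_comp]
  exact extV_botIso m a'

theorem ofComponents_mapIso {V : Type*} [Category V] [Preadditive V] [HasBinaryBiproducts V]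
    {X X' Y Y' Z Z' : V} {a : X ⟶ X'} {b : X ⟶ Y'} {d : Y ⟶ Y'} {b' : X ⟶ Z'} {d' : Z ⟶ Z'}
    (e : Y ≅ Z) (e' : Y' ≅ Z') (hb : b ≫ e'.hom = b') (hd : d ≫ e'.hom = e.hom ≫ d')
    {s s' t : ℤˣ} (hs : s' = s) (ht : t = -s) :
    Biprod.ofComponents a ((s : ℤ) • b) 0 d ≫ (biprod.mapIso (Iso.refl X') (s' • e')).hom =
      (biprod.mapIso (Iso.refl X) (t • e)).hom ≫ Biprod.ofComponents a b' 0 (-d') := by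
  subst hs ht
  apply biprod.hom_ext' <;> apply biprod.hom_ext <;>
    simp [Biprod.ofComponents, hb, hd, Units.smul_def, smul_smul, ← Units.val_mul]

variable [HasBinaryBiproducts (Mat_ C)]

/-- The total complex is isomorphic to `coneCx`; the signs are moved from the vertical maps to the
bottom row. -/
noncomputable def totIso : tot (rowMap (hD := hD) (hD' := hD') v hv m) ≅ coneCx hD hD' hv m :=
  HomologicalComplex.Hom.isoOfComponents
    (fun i => biprod.mapIso (Iso.refl (topX G m i))
      ((i - 1).negOnePow • rowBotIso hD' m (i - 1) i (by omega)))
    (by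
      rintro i _ rfl
      have hd : (tot (rowMap (hD := hD) (hD' := hD') v hv m)).d i (i + 1) =
        totD (rowMap (hD := hD) (hD' := hD') v hv m) i := CochainComplex.of_d ..
      have hd' : (row D hD m).d i (i + 1) = rowD D m i := CochainComplex.of_d ..
      rw [hd, Elimination.coneCx_d, totD, hd']
      refine (ofComponents_mapIso (X := topX G m i) (X' := topX G m (i + 1)) _ _ ?_ ?_ ?_ ?_).symm
      · refine (Category.assoc _ _ _).trans ?_
        exact rowMap_rowBotIso hD hD' hv m _ i (by omega) (by omega)
      · exact row_d_rowBotIso hD' m (i - 1) (i + 1 - 1) i (by omega) (by omega)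
      · rw [add_sub_cancel_right]
      · rw [Int.negOnePow_sub, Int.negOnePow_one, mul_neg_one])

/-- Given an elimination, the total complex is equivalent to the top row with one more term. -/
theorem Elimination.equivalent_tot [HasZeroObject (Mat_ C)] (F : Elimination D D' v) :
    Equivalent ⟨tot (rowMap (hD := hD) (hD' := hD') v hv m),
        (row_bounded _ _ _).tot (row_bounded _ _ _) _⟩
      ⟨row D hD (m + 1), row_bounded D hD (m + 1)⟩ :=
  let e := totIso hD hD' hv m
  have hK : Bounded (coneCx hD hD' hv m) :=
    ((row_bounded D hD m).tot (row_bounded D' hD' m) _).of_retract e.inv e.hom e.inv_hom_id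
  (Equivalent.of_iso (L := ⟨_, hK⟩) e).trans (F.equivalent_coneCx hD hD' hv m hK)

end reindex

/-! ### The splitting of the bottom row by `φ` and `ψ` -/

section decomposition

open Diagram Term

variable {n : ℕ} {d e k d' e' : ℤ}

/-- The component `S ∘ S → S{-1}` of `φ` if `j` is even, and of `ψ` if `j` is odd. -/
def tFst : ∀ (_ : ℕ) (_ : d = -1), Term n gSS gS d
  | 0, hd => gen (.fwd .phi (0 : Fin 2)) .base (by simp [IsoGen.deg, hd])
  | 1, hd => gen (.fwd .psi (0 : Fin 2)) .base (by simp [IsoGen.deg, hd])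
  | j + 2, hd => tFst j hd

/-- The component `S ∘ S → S{1}` of `φ` if `j` is even, and of `ψ` if `j` is odd. -/
def tSnd : ∀ (_ : ℕ) (_ : d = 1), Term n gSS gS d
  | 0, hd => gen (.fwd .phi (1 : Fin 2)) .base (by simp [IsoGen.deg, hd])
  | 1, hd => gen (.fwd .psi (1 : Fin 2)) .base (by simp [IsoGen.deg, hd])
  | j + 2, hd => tSnd j hd

/-- The component `S{-1} → S ∘ S` of the inverse of `φ` if `j` is even, and of `ψ` if `j` is
odd. -/
def tInl : ∀ (_ : ℕ) (_ : d = 1), Term n gS gSS d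
  | 0, hd => gen (.bwd .phi (0 : Fin 2)) .base (by simp [IsoGen.deg, hd])
  | 1, hd => gen (.bwd .psi (0 : Fin 2)) .base (by simp [IsoGen.deg, hd])
  | j + 2, hd => tInl j hd

/-- The component `S{1} → S ∘ S` of the inverse of `φ` if `j` is even, and of `ψ` if `j` is
odd. -/
def tInr : ∀ (_ : ℕ) (_ : d = -1), Term n gS gSS d
  | 0, hd => gen (.bwd .phi (1 : Fin 2)) .base (by simp [IsoGen.deg, hd])
  | 1, hd => gen (.bwd .psi (1 : Fin 2)) .base (by simp [IsoGen.deg, hd])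
  | j + 2, hd => tInr j hd

variable {E : Relations n}

namespace Cong

/-- The identification `id₂ ∘ id₂ = id₂` turns `χ₀ ∘ 1` into `χ₀`. -/
theorem left_eq (hd : d = 1) : Cong E (tLeft hd) (tChi0 hd) := by
  subst hd
  refine .trans (assocL _ _ _ _ _) ?_
  refine .trans (.seq_congr _ (.symm (.unit_bot (el .chi0) (.unit_bot id2) (.unit_bot gS) rfl rfl
    rfl)) (.refl _)) ?_
  refine .trans (assocR _ _ _ _ _) (.trans (.seq_congr (e := 0) _ (.refl _) ?_) (.seq_id _ rfl rfl))
  exact .trans (.iso_seq _ _ (.refl _) rfl rfl _ rfl) (.iso_self _ rfl)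

theorem inr_snd (hE : ContainsTwoStrand E) : ∀ (j : ℕ) (hd : d = -1) (he : e = 1) (hk : k = d + e)
    (hz : k = 0), Cong E (seq (tInr j hd) (tSnd j he) hk) (id gS hz)
  | 0, hd, he, hk, hz => by
    subst hd he hz
    exact .of (hE (.inv_phi (InvRel.bwd_fwd (n := n) (g := .phi) (1 : Fin 2))))
  | 1, hd, he, hk, hz => by
    subst hd he hz
    exact .of (hE (.inv_psi (InvRel.bwd_fwd (n := n) (g := .psi) (1 : Fin 2))))
  | j + 2, hd, he, hk, hz => inr_snd hE j hd he hk hz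

theorem inr_fst (hE : ContainsTwoStrand E) : ∀ (j : ℕ) (hd : d = -1) (he : e = -1)
    (hk : k = d + e), Cong E (seq (tInr j hd) (tFst j he) hk) (zero _ _ _)
  | 0, hd, he, hk => by
    subst hd he hk
    exact .of (hE (.inv_phi (InvRel.bwd_fwd_ne (n := n) (g := .phi) (1 : Fin 2) (0 : Fin 2)
      (show (1 : Fin 2) ≠ 0 by decide))))
  | 1, hd, he, hk => by
    subst hd he hk
    exact .of (hE (.inv_psi (InvRel.bwd_fwd_ne (n := n) (g := .psi) (1 : Fin 2) (0 : Fin 2)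
      (show (1 : Fin 2) ≠ 0 by decide))))
  | j + 2, hd, he, hk => inr_fst hE j hd he hk

theorem fst_inl_add_snd_inr (hE : ContainsTwoStrand E) : ∀ (j : ℕ) (hd : d = -1) (he : e = 1)
    (hk : k = d + e) (hd' : d' = 1) (he' : e' = -1) (hk' : k = d' + e') (hz : k = 0),
    Cong E (add (seq (tFst j hd) (tInl j he) hk) (seq (tSnd j hd') (tInr j he') hk')) (id gSS hz)
  | 0, hd, he, hk, hd', he', hk', hz => by
    subst hd he hd' he' hz
    exact .trans (.add_congr (.refl _) (.symm (.add_zero _)))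
      (.of (hE (.inv_phi .fwd_bwd)))
  | 1, hd, he, hk, hd', he', hk', hz => by
    subst hd he hd' he' hz
    exact .trans (.add_congr (.refl _) (.symm (.add_zero _)))
      (.of (hE (.inv_psi .fwd_bwd)))
  | j + 2, hd, he, hk, hd', he', hk', hz => fst_inl_add_snd_inr hE j hd he hk hd' he' hk' hz

theorem top_fst (hE : ContainsTwoStrand E) : ∀ (j : ℕ) (hd : d = 1) (he : e = -1) (hk : k = d + e)
    (hz : k = 0), Cong E (seq (tTop hd) (tFst j he) hk) (id gS hz)
  | 0, hd, he, hk, hz => by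
    subst hd he hz
    exact .of (hE .moy2b_0)
  | 1, hd, he, hk, hz => by
    subst hd he hz
    exact .of (hE .moy2c_0)
  | j + 2, hd, he, hk, hz => top_fst hE j hd he hk hz

theorem top_snd (hE : ContainsTwoStrand E) : ∀ (j : ℕ) (hd : d = 1) (he : e = 1) (hk : k = d + e)
    (hk' : k = 2), Cong E (seq (tTop hd) (tSnd j he) hk) (tAG j hk')
  | 0, hd, he, hk, hk' => by
    subst hd he hk
    exact .of (hE .moy2b_1)
  | 1, hd, he, hk, hk' => by
    subst hd he hk
    exact .of (hE .moy2c_1)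
  | j + 2, hd, he, hk, hk' => top_snd hE j hd he hk hk'

theorem bot_fst (hE : ContainsTwoStrand E) (hd : d = 1) (he : e = -1) (hk : k = d + e)
    (hz : k = 0) : Cong E (seq (tBot hd) (tFst 0 he) hk) (id gS hz) := by
  subst hd he hz
  exact .of (hE .moy2a_0)

theorem bot_snd (hE : ContainsTwoStrand E) (hd : d = 1) (he : e = 1) (hk : k = d + e) :
    Cong E (seq (tBot hd) (tSnd 0 he) hk) (zero _ _ _) := by
  subst hd he hk
  exact .of (hE .moy2a_1)

theorem right_fst (hE : ContainsTwoStrand E) : ∀ (j : ℕ) (hd : d = 2) (he : e = -1)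
    (hk : k = d + e) (hk' : k = 1),
    Cong E (seq (tRight (tAG j hd)) (tFst (j + 1) he) hk) (tSnd j hk')
  | 0, hd, he, hk, hk' => by
    subst hd he hk
    exact .of (hE .shift1_0)
  | 1, hd, he, hk, hk' => by
    subst hd he hk
    exact .of (hE .shift2_0)
  | j + 2, hd, he, hk, hk' => right_fst hE j hd he hk hk'

theorem right_snd (hE : ContainsTwoStrand E) : ∀ (j : ℕ) (hd : d = 2) (he : e = 1)
    (hk : k = d + e), Cong E (seq (tRight (tAG j hd)) (tSnd (j + 1) he) hk) (zero _ _ _)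
  | 0, hd, he, hk => by
    subst hd he hk
    exact .of (hE .shift1_1)
  | 1, hd, he, hk => by
    subst hd he hk
    exact .of (hE .shift2_1)
  | j + 2, hd, he, hk => right_snd hE j hd he hk

end Cong

/-- The isomorphisms `φ` and `ψ`, used alternately, split the bottom row of the bicomplex. -/
def rowElimination (hE : ContainsTwoStrand E) : Elimination (topD E) (botD E) (vert E) where
  q
    | 0 => 0
    | j + 1 => ShiftedGraph.homOf (tFst j (by simp only [topG, botG]; ring))
  β
    | 0 => 0
    | j + 1 => ShiftedGraph.homOf (tInl j (by simp only [topG, botG]; ring))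
  π
    | 0 => ShiftedGraph.homOf (id gS (by simp [topG, botG]))
    | j + 1 => ShiftedGraph.homOf (tSnd j (by simp only [topG, botG]; push_cast; ring))
  κ
    | 0 => ShiftedGraph.homOf (id gS (by simp [topG, botG]))
    | j + 1 => ShiftedGraph.homOf (tInr j (by simp only [topG, botG]; push_cast; ring))
  q_zero := rfl
  κ_π
    | 0 => GHom.sound (.id_seq _ _ _)
    | j + 1 => GHom.sound (.inr_snd hE j _ _ _ _)
  κ_q
    | 0 => comp_zero
    | j + 1 => GHom.sound (.inr_fst hE j _ _ _)
  total
    | 0 => (congrArg (· + _) zero_comp).trans ((zero_add _).trans (GHom.sound (.id_seq _ _ _)))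
    | j + 1 => GHom.sound (.fst_inl_add_snd_inr hE j _ _ _ _ _ _ _)
  v_q j := GHom.sound (.top_fst hE j _ _ _ _)
  v_π
    | 0 => GHom.sound (.trans (.seq_id _ _ _) (.left_eq _))
    | j + 1 => GHom.sound (.top_snd hE j _ _ _ _)
  D'_q
    | 0 => GHom.sound (.bot_fst hE _ _ _ _)
    | j + 1 => GHom.sound (.right_fst hE j _ _ _ _)
  D'_π
    | 0 => GHom.sound (.bot_snd hE _ _ _)
    | j + 1 => GHom.sound (.right_snd hE j _ _ _)

theorem equivalent_totalComplex (hE : ContainsTwoStrand E) (m : ℕ) :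
    Equivalent (totalComplex E hE m) (mainComplex E hE (m + 1)) :=
  (rowElimination hE).equivalent_tot (topD_comp hE) (botD_comp hE) (vert_comm E) m

end decomposition

end KR

theorem mainTheorem11 (n : ℕ) (hn : 2 ≤ n) :
    (∀ k : ℕ,
      KR.Equivalent (KR.totalComplex (KR.KRRel n) KR.KRRel.contains (2 * k))
        (KR.mainComplex (KR.KRRel n) KR.KRRel.contains (2 * k + 1)) ∧
      KR.Equivalent (KR.totalComplex (KR.KRRel n) KR.KRRel.contains (2 * k + 1))
        (KR.mainComplex (KR.KRRel n) KR.KRRel.contains (2 * k + 2))) ∧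
    (∀ k : ℕ,
      KR.Equivalent (KR.totalComplex (KR.TwoStrandRel n) KR.TwoStrandRel.contains (2 * k))
        (KR.mainComplex (KR.TwoStrandRel n) KR.TwoStrandRel.contains (2 * k + 1)) ∧
      KR.Equivalent (KR.totalComplex (KR.TwoStrandRel n) KR.TwoStrandRel.contains (2 * k + 1))
        (KR.mainComplex (KR.TwoStrandRel n) KR.TwoStrandRel.contains (2 * k + 2))) :=
  ⟨fun _ => ⟨KR.equivalent_totalComplex _ _, KR.equivalent_totalComplex _ _⟩,
    fun _ => ⟨KR.equivalent_totalComplex _ _, KR.equivalent_totalComplex _ _⟩⟩
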